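/- Let $H_4$ be the Nappi–Witten Lie algebra: the complex Lie algebra with basis $a,b,c,d$ and brackets $[a,b]=c$, $[d,a]=a$, $[d,b]=-b$, $[c,a]=[c,b]=[c,d]=0$, with the symmetric invariant bilinear form given by $(a,b)=(c,d)=1$, all other pairings of basis vectors being $0$. Let $\widehat H_4=H_4\otimes\mathbb C[t,t^{-1}]\oplus\mathbb C\mathbf k$, with $\mathbf k$ central and $[x\otimes t^m,y\otimes t^n]=[x,y]\otimes t^{m+n}+m(x,y)\delta_{m+n,0}\mathbf k$, and write $x(m)=x\otimes t^m$. Let $\tau$ be the involution of $H_4$ with $\tau a=b$, $\tau b=a$, $\tau c=-c$, $\tau d=-d$, and let $\widehat H_4[\tau]$ be the fixed subalgebra of the automorphism $h\otimes t^m+s\mathbf k\mapsto(-1)^m\tau(h)\otimes t^m+s\mathbf k$ of $\widehat H_4$. Let $\widehat H_4[\tau]^{(+)}$ be the subalgebra spanned by the $(a+b)(n)$ with $n>0$ even and the $(a-b)(m),c(m),d(m)$ with $m>0$ odd. For a Lie algebra homomorphism $\psi:\widehat H_4[\tau]^{(+)}\to\mathbb C$, let $\mathbb C_\psi$ be the corresponding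 one-dimensional module, $M_\psi=U(\widehat H_4[\tau])\otimes_{U(\widehat H_4[\tau]^{(+)})}\mathbb C_\psi$, and, for $\xi\in\mathbb C$, $L_{\psi,\xi}=M_\psi/(\mathbf k-\xi)M_\psi$; let $\bar\omega\in L_{\psi,\xi}$ be the image of $1\otimes1$. A vector $v\neq0$ of an $\widehat H_4[\tau]$-module is a Whittaker vector of type $\chi$, where $\chi:\widehat H_4[\tau]^{(+)}\to\mathbb C$ is a Lie algebra homomorphism, if $xv=\chi(x)v$ for all $x\in\widehat H_4[\tau]^{(+)}$. An odd partition is a finite (possibly empty) non-decreasing sequence $\eta=(\eta_1,\dots,\eta_l)$ of positive odd integers, and $c(-\eta)=c(-\eta_1)\cdots c(-\eta_l)\in U(\widehat H_4[\tau])$ (equal to $1$ if $\eta$ is empty). Theorem 4.3. Let $\psi:\widehat H_4[\tau]^{(+)}\to\mathbb C$ be a Lie algebra homomorphism with $\psi(c(1))\neq0$. Then every Whittaker vector of $L_{\psi,0}$ (of any type $\chi$) is a nonzero linear combination of $\bar\omega$ and the vectors $c(-\eta)\bar\omega$, where $\eta$ runs over the odd partitions. Conversely, every nonzero linear combination of these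 vectors is a Whittaker vector of $L_{\psi,0}$ of type $\psi$. -/

import Mathlib

open scoped TensorProduct

noncomputable section

namespace NappiWitten

/-- The Nappi-Witten Lie algebra `H₄`: a four-dimensional complex vector space; the fields are the
coordinates with respect to the basis `a, b, c, d`. -/
@[ext]
structure H4 where
  a : ℂ
  b : ℂ
  c : ℂ
  d : ℂ

namespace H4

instance : Zero H4 := ⟨⟨0, 0, 0, 0⟩⟩
instance : Add H4 := ⟨fun x y => ⟨x.a + y.a, x.b + y.b, x.c + y.c, x.d + y.d⟩⟩
instance : Neg H4 := ⟨fun x => ⟨-x.a, -x.b, -x.c, -x.d⟩⟩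
instance : Sub H4 := ⟨fun x y => ⟨x.a - y.a, x.b - y.b, x.c - y.c, x.d - y.d⟩⟩
instance : SMul ℂ H4 := ⟨fun r x => ⟨r * x.a, r * x.b, r * x.c, r * x.d⟩⟩

@[simp] theorem zero_a : (0 : H4).a = 0 := rfl
@[simp] theorem zero_b : (0 : H4).b = 0 := rfl
@[simp] theorem zero_c : (0 : H4).c = 0 := rfl
@[simp] theorem zero_d : (0 : H4).d = 0 := rfl
@[simp] theorem add_a (x y : H4) : (x + y).a = x.a + y.a := rfl
@[simp] theorem add_b (x y : H4) : (x + y).b = x.b + y.b := rfl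
@[simp] theorem add_c (x y : H4) : (x + y).c = x.c + y.c := rfl
@[simp] theorem add_d (x y : H4) : (x + y).d = x.d + y.d := rfl
@[simp] theorem neg_a (x : H4) : (-x).a = -x.a := rfl
@[simp] theorem neg_b (x : H4) : (-x).b = -x.b := rfl
@[simp] theorem neg_c (x : H4) : (-x).c = -x.c := rfl
@[simp] theorem neg_d (x : H4) : (-x).d = -x.d := rfl
@[simp] theorem sub_a (x y : H4) : (x - y).a = x.a - y.a := rfl
@[simp] theorem sub_b (x y : H4) : (x - y).b = x.b - y.b := rfl
@[simp] theorem sub_c (x y : H4) : (x - y).c = x.c - y.c := rfl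
@[simp] theorem sub_d (x y : H4) : (x - y).d = x.d - y.d := rfl
@[simp] theorem smul_a (r : ℂ) (x : H4) : (r • x).a = r * x.a := rfl
@[simp] theorem smul_b (r : ℂ) (x : H4) : (r • x).b = r * x.b := rfl
@[simp] theorem smul_c (r : ℂ) (x : H4) : (r • x).c = r * x.c := rfl
@[simp] theorem smul_d (r : ℂ) (x : H4) : (r • x).d = r * x.d := rfl

instance : AddCommGroup H4 where
  add_assoc x y z := by ext <;> simp [add_assoc]
  zero_add x := by ext <;> simp
  add_zero x := by ext <;> simp
  add_comm x y := by ext <;> simp [add_comm]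
  neg_add_cancel x := by ext <;> simp
  sub_eq_add_neg x y := by ext <;> simp [sub_eq_add_neg]
  nsmul := nsmulRec
  zsmul := zsmulRec

instance : Module ℂ H4 where
  one_smul x := by ext <;> simp
  mul_smul r s x := by ext <;> simp [mul_assoc]
  smul_zero r := by ext <;> simp
  smul_add r x y := by ext <;> simp [mul_add]
  add_smul r s x := by ext <;> simp [add_mul]
  zero_smul x := by ext <;> simp

/-- The basis vectors `a`, `b`, `c`, `d` of `H₄`. -/
def ea : H4 := ⟨1, 0, 0, 0⟩
def eb : H4 := ⟨0, 1, 0, 0⟩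
def ec : H4 := ⟨0, 0, 1, 0⟩
def ed : H4 := ⟨0, 0, 0, 1⟩

/-- The bracket of `H₄`, the bilinear extension of `[a, b] = c`, `[d, a] = a`, `[d, b] = -b`,
`[c, d] = [c, a] = [c, b] = 0`. -/
instance : Bracket H4 H4 :=
  ⟨fun x y => ⟨x.d * y.a - x.a * y.d, x.b * y.d - x.d * y.b, x.a * y.b - x.b * y.a, 0⟩⟩

@[simp] theorem lie_a (x y : H4) : (⁅x, y⁆).a = x.d * y.a - x.a * y.d := rfl
@[simp] theorem lie_b (x y : H4) : (⁅x, y⁆).b = x.b * y.d - x.d * y.b := rfl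
@[simp] theorem lie_c (x y : H4) : (⁅x, y⁆).c = x.a * y.b - x.b * y.a := rfl
@[simp] theorem lie_d (x y : H4) : (⁅x, y⁆).d = 0 := rfl

instance : LieRing H4 where
  add_lie x y z := by ext <;> simp <;> ring
  lie_add x y z := by ext <;> simp <;> ring
  lie_self x := by ext <;> simp <;> ring
  leibniz_lie x y z := by ext <;> simp <;> ring

instance : LieAlgebra ℂ H4 where
  lie_smul t x y := by ext <;> simp <;> ring

theorem lie_ea_eb : ⁅ea, eb⁆ = ec := by ext <;> simp [ea, eb, ec]
theorem lie_ed_ea : ⁅ed, ea⁆ = ea := by ext <;> simp [ed, ea]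
theorem lie_ed_eb : ⁅ed, eb⁆ = -eb := by ext <;> simp [ed, eb]
theorem lie_ec (x : H4) : ⁅ec, x⁆ = 0 := by ext <;> simp [ec]

/-- The symmetric invariant bilinear form on `H₄` with `(a, b) = (c, d) = 1` and all other pairings
of basis vectors equal to `0`. -/
def form : LinearMap.BilinForm ℂ H4 :=
  LinearMap.mk₂ ℂ (fun x y => x.a * y.b + x.b * y.a + x.c * y.d + x.d * y.c)
    (by intros; simp; ring) (by intros; simp; ring) (by intros; simp; ring) (by intros; simp; ring)

theorem form_apply (x y : H4) :
    form x y = x.a * y.b + x.b * y.a + x.c * y.d + x.d * y.c := rfl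

theorem neg_form_isSymm : (-form).IsSymm :=
  ⟨fun x y => by simp [form_apply]; ring⟩

theorem neg_form_lieInvariant : (-form).lieInvariant H4 := by
  intro x y z
  simp [form_apply]
  ring

/-- The involution `τ` of `H₄`: `a ↦ b`, `b ↦ a`, `c ↦ -c`, `d ↦ -d`. -/
def tau : H4 →ₗ⁅ℂ⁆ H4 where
  toFun x := ⟨x.b, x.a, -x.c, -x.d⟩
  map_add' x y := by ext <;> simp <;> ring
  map_smul' r x := by ext <;> simp
  map_lie' {x y} := by ext <;> simp <;> ring

theorem tau_apply (x : H4) : tau x = ⟨x.b, x.a, -x.c, -x.d⟩ := rfl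

end H4

/-- The loop algebra `H₄ ⊗ ℂ[t, t⁻¹]` (Mathlib writes the Laurent polynomials on the left). -/
abbrev Loop : Type := LieAlgebra.loopAlgebra ℂ ℤ H4

/-- The two-cocycle `(x ⊗ tᵐ, y ⊗ tⁿ) ↦ m (x, y) δ_{m+n,0}` of the loop algebra. Mathlib's cocycle
attached to a form `Φ` is `n Φ(x, y) δ_{m+n,0}`, whence the sign. -/
abbrev cocycle :
    LieModule.Cohomology.twoCocycle ℂ Loop (TrivialLieModule ℂ Loop ℂ) :=
  LieAlgebra.LoopAlgebra.twoCocycleOfBilinear ℂ ℤ H4 (-H4.form) H4.neg_form_lieInvariant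
    H4.neg_form_isSymm

/-- The affine Nappi-Witten Lie algebra `Ĥ₄ = H₄ ⊗ ℂ[t, t⁻¹] ⊕ ℂ k`. -/
abbrev Affine : Type := LieAlgebra.ofTwoCocycle cocycle

namespace Affine

/-- The element `f + s k` of `Ĥ₄`. -/
def mk (f : Loop) (s : ℂ) : Affine :=
  LieAlgebra.ofProd cocycle (f, (TrivialLieModule.equiv ℂ Loop ℂ).symm s)

/-- The loop part of an element of `Ĥ₄`. -/
def loop (u : Affine) : Loop := ((LieAlgebra.ofProd cocycle).symm u).1

/-- The coefficient of `k` of an element of `Ĥ₄`. -/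
def coeff (u : Affine) : ℂ :=
  TrivialLieModule.equiv ℂ Loop ℂ ((LieAlgebra.ofProd cocycle).symm u).2

/-- The element `x(m) = x ⊗ tᵐ` of `Ĥ₄`. -/
def mode (x : H4) (m : ℤ) : Affine :=
  mk (AddMonoidAlgebra.single m 1 ⊗ₜ[ℂ] x) 0

/-- The central element `k` of `Ĥ₄`. -/
def central : Affine := mk 0 1

@[simp] theorem mk_loop_coeff (u : Affine) : mk u.loop u.coeff = u := rfl
@[simp] theorem loop_mk (f : Loop) (s : ℂ) : (mk f s).loop = f := rfl
@[simp] theorem coeff_mk (f : Loop) (s : ℂ) : (mk f s).coeff = s := rfl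

theorem mk_add (f g : Loop) (s r : ℂ) : mk (f + g) (s + r) = mk f s + mk g r := rfl
theorem mk_smul (z : ℂ) (f : Loop) (s : ℂ) : mk (z • f) (z * s) = z • mk f s := rfl

theorem lie_eq (u v : Affine) :
    ⁅u, v⁆ = mk ⁅u.loop, v.loop⁆
      (LieAlgebra.LoopAlgebra.residuePairing ℂ ℤ H4 (-H4.form) u.loop v.loop) := by
  rw [LieAlgebra.bracket_ofTwoCocycle]
  simp [mk, loop, trivial_lie_zero]

theorem residuePairing_single (x y : H4) (m n : ℤ) :
    LieAlgebra.LoopAlgebra.residuePairing ℂ ℤ H4 (-H4.form)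
      (AddMonoidAlgebra.single m 1 ⊗ₜ[ℂ] x) (AddMonoidAlgebra.single n 1 ⊗ₜ[ℂ] y) =
      if m + n = 0 then (m : ℂ) * H4.form x y else 0 := by
  rw [LieAlgebra.LoopAlgebra.residuePairing_apply_apply,
    LieAlgebra.LoopAlgebra.toFinsupp_single_tmul, LieAlgebra.LoopAlgebra.toFinsupp_single_tmul,
    Finsupp.sum_single_index (by simp)]
  by_cases h : m + n = 0
  · obtain rfl : n = -m := by omega
    simp
  · rw [if_neg h, Finsupp.single_eq_of_ne (by omega)]
    simp

/-- The defining bracket `[x(m), y(n)] = [x, y](m + n) + m (x, y) δ_{m+n,0} k`. -/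
theorem lie_mode_mode (x y : H4) (m n : ℤ) :
    ⁅mode x m, mode y n⁆ = mode ⁅x, y⁆ (m + n) +
      (if m + n = 0 then (m : ℂ) * H4.form x y else 0) • central := by
  rw [lie_eq]
  simp only [mode, loop_mk, residuePairing_single, central, ← mk_smul, ← mk_add,
    LieAlgebra.ExtendScalars.bracket_tmul, AddMonoidAlgebra.single_mul_single, mul_one, smul_zero,
    add_zero, zero_add]

theorem lie_central (u : Affine) : ⁅u, central⁆ = 0 := by
  rw [lie_eq]
  simp [central]
  rfl

/-- The algebra automorphism `tᵐ ↦ (-1)ᵐ tᵐ` of the Laurent polynomials. -/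
def signTwist : AddMonoidAlgebra ℂ ℤ →ₐ[ℂ] AddMonoidAlgebra ℂ ℤ :=
  AddMonoidAlgebra.lift ℂ (AddMonoidAlgebra ℂ ℤ) ℤ
    { toFun m := AddMonoidAlgebra.single m.toAdd ((-1 : ℂ) ^ m.toAdd)
      map_one' := by
        rw [toAdd_one, zpow_zero]; rfl
      map_mul' m n := by
        rw [AddMonoidAlgebra.single_mul_single, toAdd_mul, zpow_add₀ (by norm_num)] }

theorem signTwist_single (m : ℤ) :
    signTwist (AddMonoidAlgebra.single m 1) = (-1 : ℂ) ^ m • AddMonoidAlgebra.single m 1 := by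
  rw [signTwist, AddMonoidAlgebra.lift_single, one_smul, AddMonoidAlgebra.smul_single, smul_eq_mul,
    mul_one]
  rfl

/-- The automorphism `h ⊗ tᵐ ↦ (-1)ᵐ τ(h) ⊗ tᵐ` of the loop algebra. -/
def tauLoop : Loop →ₗ⁅ℂ⁆ Loop := LieAlgebra.ExtendScalars.map signTwist H4.tau

theorem tauLoop_single (x : H4) (m : ℤ) :
    tauLoop (AddMonoidAlgebra.single m 1 ⊗ₜ[ℂ] x) =
      (-1 : ℂ) ^ m • (AddMonoidAlgebra.single m 1 ⊗ₜ[ℂ] H4.tau x) := by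
  rw [tauLoop, LieAlgebra.ExtendScalars.map_apply_tmul, signTwist_single, TensorProduct.smul_tmul']

theorem residuePairing_tauLoop (f g : Loop) :
    LieAlgebra.LoopAlgebra.residuePairing ℂ ℤ H4 (-H4.form) (tauLoop f) (tauLoop g) =
      LieAlgebra.LoopAlgebra.residuePairing ℂ ℤ H4 (-H4.form) f g := by
  suffices h : (LieAlgebra.LoopAlgebra.residuePairing ℂ ℤ H4 (-H4.form)).compl₁₂
      (tauLoop : Loop →ₗ[ℂ] Loop) (tauLoop : Loop →ₗ[ℂ] Loop) =
      LieAlgebra.LoopAlgebra.residuePairing ℂ ℤ H4 (-H4.form) from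
    congrArg (fun B : LinearMap.BilinForm ℂ Loop => B f g) h
  ext m x n y
  change LieAlgebra.LoopAlgebra.residuePairing ℂ ℤ H4 (-H4.form)
      (tauLoop (AddMonoidAlgebra.single m 1 ⊗ₜ[ℂ] x))
      (tauLoop (AddMonoidAlgebra.single n 1 ⊗ₜ[ℂ] y)) =
    LieAlgebra.LoopAlgebra.residuePairing ℂ ℤ H4 (-H4.form)
      (AddMonoidAlgebra.single m 1 ⊗ₜ[ℂ] x) (AddMonoidAlgebra.single n 1 ⊗ₜ[ℂ] y)
  rw [tauLoop_single, tauLoop_single, map_smul, map_smul, LinearMap.smul_apply,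
    residuePairing_single, residuePairing_single]
  by_cases h : m + n = 0
  · have h1 : (-1 : ℂ) ^ m * (-1 : ℂ) ^ n = 1 := by
      rw [← zpow_add₀ (by norm_num), h, zpow_zero]
    have h2 : H4.form (H4.tau x) (H4.tau y) = H4.form x y := by
      simp [H4.form_apply, H4.tau_apply]; ring
    rw [if_pos h, if_pos h, h2, smul_eq_mul, smul_eq_mul, ← mul_assoc, mul_comm (_ ^ n), h1,
      one_mul]
  · simp [h]

/-- The automorphism `τ̂(h ⊗ tᵐ + s k) = (-1)ᵐ τ(h) ⊗ tᵐ + s k` of `Ĥ₄`. -/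
def tauHat : Affine →ₗ⁅ℂ⁆ Affine where
  toFun u := mk (tauLoop u.loop) u.coeff
  map_add' u v := by
    rw [← mk_add, ← map_add]; rfl
  map_smul' z u := by
    rw [RingHom.id_apply, ← mk_smul, ← map_smul]; rfl
  map_lie' {u v} := by
    simp only [lie_eq, loop_mk, coeff_mk, LieHom.map_lie, residuePairing_tauLoop]

theorem tauHat_mode (x : H4) (m : ℤ) : tauHat (mode x m) = (-1 : ℂ) ^ m • mode (H4.tau x) m := by
  change mk (tauLoop (AddMonoidAlgebra.single m 1 ⊗ₜ[ℂ] x)) 0 = _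
  rw [tauLoop_single, mode, ← mk_smul, mul_zero]

theorem tauHat_central : tauHat central = central := by
  change mk (tauLoop 0) 1 = mk 0 1
  rw [map_zero]

end Affine

open NappiWitten.Affine

/-- The twisted affine Nappi-Witten Lie algebra `Ĥ₄[τ]`, the fixed points of `τ̂` in `Ĥ₄`. -/
def twistedSubalgebra : LieSubalgebra ℂ Affine where
  carrier := {u | tauHat u = u}
  add_mem' {u v} hu hv := by
    simp only [Set.mem_ofPred_eq] at *
    rw [map_add, hu, hv]
  zero_mem' := map_zero tauHat
  smul_mem' z u hu := by
    simp only [Set.mem_ofPred_eq] at *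
    rw [map_smul, hu]
  lie_mem' {u v} hu hv := by
    simp only [Set.mem_ofPred_eq] at *
    rw [LieHom.map_lie, hu, hv]

theorem mem_twistedSubalgebra {u : Affine} : u ∈ twistedSubalgebra ↔ tauHat u = u := Iff.rfl

/-- `Ĥ₄[τ]` as a Lie algebra in its own right. -/
abbrev Twisted : Type := twistedSubalgebra

namespace Twisted

/-- The element `(a + b)(n)`, `n` even. -/
def aAddB (n : ℤ) (hn : Even n) : Twisted :=
  ⟨mode (H4.ea + H4.eb) n, by
    have h : H4.tau (H4.ea + H4.eb) = H4.ea + H4.eb := by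
      ext <;> simp [H4.tau_apply, H4.ea, H4.eb]
    rw [mem_twistedSubalgebra, tauHat_mode, h, hn.neg_one_zpow, one_smul]⟩

theorem odd_mode_mem {x : H4} (hx : H4.tau x = -x) {m : ℤ} (hm : Odd m) :
    mode x m ∈ twistedSubalgebra := by
  rw [mem_twistedSubalgebra, tauHat_mode, hx, hm.neg_one_zpow, mode, ← mk_smul,
    TensorProduct.tmul_neg, smul_neg, neg_smul, one_smul, neg_neg, mul_zero]
  rfl

/-- The element `(a - b)(m)`, `m` odd. -/
def aSubB (m : ℤ) (hm : Odd m) : Twisted :=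
  ⟨mode (H4.ea - H4.eb) m,
    odd_mode_mem (by ext <;> simp [H4.tau_apply, H4.ea, H4.eb]) hm⟩

/-- The element `c(m)`, `m` odd. -/
def c (m : ℤ) (hm : Odd m) : Twisted :=
  ⟨mode H4.ec m, odd_mode_mem (by ext <;> simp [H4.tau_apply, H4.ec]) hm⟩

/-- The element `d(m)`, `m` odd. -/
def d (m : ℤ) (hm : Odd m) : Twisted :=
  ⟨mode H4.ed m, odd_mode_mem (by ext <;> simp [H4.tau_apply, H4.ed]) hm⟩

/-- The central element `k`. -/
def k : Twisted := ⟨central, tauHat_central⟩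

/-- The spanning vectors `(a + b)(n)`, `(a - b)(m)`, `c(m)`, `d(m)` of `Ĥ₄[τ]⁽⁺⁾`, where `n > 0` is
even and `m > 0` is odd. -/
def posGenerators : Set Twisted :=
  {u | (∃ (n : ℤ) (hn : Even n), 0 < n ∧ u = aAddB n hn) ∨
    ∃ (m : ℤ) (hm : Odd m), 0 < m ∧ (u = aSubB m hm ∨ u = c m hm ∨ u = d m hm)}

theorem lie_eq_smul {u v w : Twisted} {x y z : H4} {m n : ℤ} (r : ℂ) (hu : (u : Affine) = mode x m)
    (hv : (v : Affine) = mode y n) (hw : (w : Affine) = mode z (m + n)) (hm : 0 < m) (hn : 0 < n)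
    (h : ⁅x, y⁆ = r • z) : ⁅u, v⁆ = r • w := by
  apply Subtype.ext
  change ⁅(u : Affine), (v : Affine)⁆ = r • (w : Affine)
  rw [hu, hv, hw, lie_mode_mode, if_neg (by omega), h, zero_smul,
    add_zero, mode, mode, ← mk_smul, TensorProduct.tmul_smul, mul_zero]

theorem lie_posGenerators_mem {u v : Twisted} (hu : u ∈ posGenerators) (hv : v ∈ posGenerators) :
    ⁅u, v⁆ ∈ Submodule.span ℂ posGenerators := by
  have key : ∀ {u v w : Twisted} {x y z : H4} {m n : ℤ} (r : ℂ), (u : Affine) = mode x m →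
      (v : Affine) = mode y n → (w : Affine) = mode z (m + n) → 0 < m → 0 < n →
      ⁅x, y⁆ = r • z → w ∈ posGenerators → ⁅u, v⁆ ∈ Submodule.span ℂ posGenerators := by
    intro u v w x y z m n r hu hv hw hm hn h hw'
    rw [lie_eq_smul r hu hv hw hm hn h]
    exact Submodule.smul_mem _ _ (Submodule.subset_span hw')
  have key0 : ∀ {u v : Twisted} {x y : H4} {m n : ℤ}, (u : Affine) = mode x m →
      (v : Affine) = mode y n → 0 < m → 0 < n → ⁅x, y⁆ = 0 →
      ⁅u, v⁆ ∈ Submodule.span ℂ posGenerators := by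
    intro u v x y m n hu hv hm hn h
    have : ⁅u, v⁆ = 0 := by
      apply Subtype.ext
      rw [LieSubalgebra.coe_bracket, hu, hv, lie_mode_mode, if_neg (by omega), h, zero_smul,
        add_zero, mode, TensorProduct.tmul_zero]
      rfl
    rw [this]
    exact Submodule.zero_mem _
  rcases hu with ⟨m, hm, hm0, rfl⟩ | ⟨m, hm, hm0, rfl | rfl | rfl⟩ <;>
    rcases hv with ⟨n, hn, hn0, rfl⟩ | ⟨n, hn, hn0, rfl | rfl | rfl⟩
  · exact key0 rfl rfl hm0 hn0 (lie_self _)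
  · exact key (w := c (m + n) (hm.add_odd hn)) (-2) rfl rfl rfl hm0 hn0
      (by ext <;> simp [H4.ea, H4.eb, H4.ec]; norm_num)
      (Or.inr ⟨_, _, by omega, Or.inr (Or.inl rfl)⟩)
  · exact key0 rfl rfl hm0 hn0 (by ext <;> simp [H4.ec])
  · exact key (w := aSubB (m + n) (hm.add_odd hn)) (-1) rfl rfl rfl hm0 hn0
      (by ext <;> simp [H4.ea, H4.eb, H4.ed])
      (Or.inr ⟨_, _, by omega, Or.inl rfl⟩)
  · exact key (w := c (m + n) (hm.add_even hn)) 2 rfl rfl rfl hm0 hn0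
      (by ext <;> simp [H4.ea, H4.eb, H4.ec]; norm_num)
      (Or.inr ⟨_, _, by omega, Or.inr (Or.inl rfl)⟩)
  · exact key0 rfl rfl hm0 hn0 (lie_self _)
  · exact key0 rfl rfl hm0 hn0 (by ext <;> simp [H4.ec])
  · exact key (w := aAddB (m + n) (hm.add_odd hn)) (-1) rfl rfl rfl hm0 hn0
      (by ext <;> simp [H4.ea, H4.eb, H4.ed])
      (Or.inl ⟨_, _, by omega, rfl⟩)
  · exact key0 rfl rfl hm0 hn0 (H4.lie_ec _)
  · exact key0 rfl rfl hm0 hn0 (H4.lie_ec _)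
  · exact key0 rfl rfl hm0 hn0 (H4.lie_ec _)
  · exact key0 rfl rfl hm0 hn0 (H4.lie_ec _)
  · exact key (w := aSubB (m + n) (hm.add_even hn)) 1 rfl rfl rfl hm0 hn0
      (by ext <;> simp [H4.ea, H4.eb, H4.ed])
      (Or.inr ⟨_, _, by omega, Or.inl rfl⟩)
  · exact key (w := aAddB (m + n) (hm.add_odd hn)) 1 rfl rfl rfl hm0 hn0
      (by ext <;> simp [H4.ea, H4.eb, H4.ed])
      (Or.inl ⟨_, _, by omega, rfl⟩)
  · exact key0 rfl rfl hm0 hn0 (by ext <;> simp [H4.ec])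
  · exact key0 rfl rfl hm0 hn0 (lie_self _)

/-- The positive part `Ĥ₄[τ]⁽⁺⁾ = Span {(a + b)(n), (a - b)(m), c(m), d(m)}`. -/
def pos : LieSubalgebra ℂ Twisted where
  toSubmodule := Submodule.span ℂ posGenerators
  lie_mem' {u v} hu hv := by
    change u ∈ Submodule.span ℂ posGenerators at hu
    change v ∈ Submodule.span ℂ posGenerators at hv
    change ⁅u, v⁆ ∈ Submodule.span ℂ posGenerators
    induction hu, hv using Submodule.span_induction₂ with
    | mem_mem x y hx hy => exact lie_posGenerators_mem hx hy
    | zero_left y hy => rw [zero_lie]; exact Submodule.zero_mem _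
    | zero_right x hx => rw [lie_zero]; exact Submodule.zero_mem _
    | add_left x y z _ _ _ h1 h2 => rw [add_lie]; exact Submodule.add_mem _ h1 h2
    | add_right x y z _ _ _ h1 h2 => rw [lie_add]; exact Submodule.add_mem _ h1 h2
    | smul_left r x y _ _ h => rw [smul_lie]; exact Submodule.smul_mem _ _ h
    | smul_right r x y _ _ h => rw [lie_smul]; exact Submodule.smul_mem _ _ h

theorem c_mem_pos (m : ℤ) (hm : Odd m) (h : 0 < m) : c m hm ∈ pos :=
  Submodule.subset_span (Or.inr ⟨m, hm, h, Or.inr (Or.inl rfl)⟩)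

end Twisted

open NappiWitten.Twisted

/-- The universal enveloping algebra `U(Ĥ₄[τ])`. -/
abbrev U : Type := UniversalEnvelopingAlgebra ℂ Twisted

/-- The universal enveloping algebra `U(Ĥ₄[τ]⁽⁺⁾)`. -/
abbrev UPos : Type := UniversalEnvelopingAlgebra ℂ pos

/-- The canonical map `Ĥ₄[τ] → U(Ĥ₄[τ])`. -/
abbrev toU (x : Twisted) : U := UniversalEnvelopingAlgebra.ι ℂ x

section

attribute [local instance 100] LieRing.ofAssociativeRing

/-- The homomorphism `U(Ĥ₄[τ]⁽⁺⁾) → U(Ĥ₄[τ])` induced by the inclusion. -/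
def UPos.incl : UPos →ₐ[ℂ] U :=
  UniversalEnvelopingAlgebra.lift ℂ ((UniversalEnvelopingAlgebra.ι ℂ).comp pos.incl)

/-- The action of `U(Ĥ₄[τ]⁽⁺⁾)` on the one-dimensional module `ℂ_ψ`: `s` acts as the scalar
`UPos.char ψ s`, where `x ∈ Ĥ₄[τ]⁽⁺⁾` acts as `ψ(x)`. -/
def UPos.char (ψ : LieAlgebra.LieCharacter ℂ pos) : UPos →ₐ[ℂ] ℂ :=
  UniversalEnvelopingAlgebra.lift ℂ ψ

end

/-- A module over `Ĥ₄[τ]` is a module over `U(Ĥ₄[τ])`. A Whittaker vector of type `ψ` is a vector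
`v ≠ 0` with `x v = ψ(x) v` for all `x ∈ Ĥ₄[τ]⁽⁺⁾`. -/
def IsWhittakerVector {M : Type*} [AddCommGroup M] [Module U M]
    (ψ : LieAlgebra.LieCharacter ℂ pos) (v : M) : Prop :=
  v ≠ 0 ∧ ∀ x : pos, toU (x : Twisted) • v = algebraMap ℂ U (ψ x) • v

/-- The relations `u s ⊗ z = u ⊗ s z` (`u ∈ U(Ĥ₄[τ])`, `s ∈ U(Ĥ₄[τ]⁽⁺⁾)`, `z ∈ ℂ_ψ`) that define the
tensor product over the noncommutative ring `U(Ĥ₄[τ]⁽⁺⁾)` as a quotient of the one over `ℂ`. -/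
def inducedRelations (ψ : LieAlgebra.LieCharacter ℂ pos) : Submodule U (U ⊗[ℂ] ℂ) :=
  Submodule.span U {w | ∃ (u : U) (s : UPos) (z : ℂ),
    w = (u * UPos.incl s) ⊗ₜ[ℂ] z - u ⊗ₜ[ℂ] (UPos.char ψ s * z)}

/-- The universal Whittaker module `M_ψ = U(Ĥ₄[τ]) ⊗_{U(Ĥ₄[τ]⁽⁺⁾)} ℂ_ψ`. -/
abbrev WhittakerM (ψ : LieAlgebra.LieCharacter ℂ pos) : Type :=
  (U ⊗[ℂ] ℂ) ⧸ inducedRelations ψ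

/-- The vector `ω = 1 ⊗ 1` of `M_ψ`. -/
def omega (ψ : LieAlgebra.LieCharacter ℂ pos) : WhittakerM ψ :=
  Submodule.Quotient.mk ((1 : U) ⊗ₜ[ℂ] (1 : ℂ))

/-- The submodule `(k - ξ) M_ψ` of `M_ψ`. -/
def kSubMul (ψ : LieAlgebra.LieCharacter ℂ pos) (ξ : ℂ) : Submodule U (WhittakerM ψ) :=
  Submodule.span U (Set.range fun m : WhittakerM ψ => (toU k - algebraMap ℂ U ξ) • m)

/-- The Whittaker module `L_{ψ,ξ} = M_ψ / (k - ξ) M_ψ`. -/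
abbrev WhittakerL (ψ : LieAlgebra.LieCharacter ℂ pos) (ξ : ℂ) : Type :=
  WhittakerM ψ ⧸ kSubMul ψ ξ

/-- The image `ω̄` of `ω` in `L_{ψ,ξ}`. -/
def omegaBar (ψ : LieAlgebra.LieCharacter ℂ pos) (ξ : ℂ) : WhittakerL ψ ξ :=
  Submodule.Quotient.mk (omega ψ)

/-- Odd partitions: finite (possibly empty) non-decreasing sequences of positive odd numbers. -/
structure OddPartition where
  parts : List ℕ
  sorted : parts.Pairwise (· ≤ ·)
  odd : ∀ i ∈ parts, Odd i

/-- `c(-η) = c(-η₁) c(-η₂) ⋯ c(-η_l) ∈ U(Ĥ₄[τ])`; it is `1` for the empty partition. -/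
def cNeg (η : OddPartition) : U :=
  (η.parts.pmap (fun (i : ℕ) (hi : Odd i) =>
    toU (c (-(i : ℤ)) ((Int.odd_coe_nat i).mpr hi).neg)) η.odd).prod

end NappiWitten

end

/-! At level zero the modes of `c` commute with the whole algebra, so `L_{ψ,0}` is a module over the
commutative algebra `R` they generate (`cAlgebra`). The point is that a vector of any type lies in
`R ω̄`.

Write `X(n)` for `(a + b)(n)` with `n` even and `(a - b)(n)` with `n` odd. A character kills
brackets, so `X(n)` and `c(n)` with `n ≥ 2` kill `ω̄`, and by cyclicity `c(1)` acts everywhere as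
the nonzero scalar `ψ(c(1))`. Replacing `X(n)` by `X(n) - s c(n)`, correcting `d(n)` accordingly and
subtracting its eigenvalue on `ω̄`, one may assume that all positive modes kill `ω̄`, with the
bracket relations unchanged. `TwistedAction` records this situation.

The module is then a Fock space over `R` in two layers. The pairing `c(m + n)` of the `y m`, `m ≥
1`, with the `y n`, `n ≤ 0`, is triangular with the unit `c(1)` on its diagonal, and inverting it
gives creation operators `hat` dual to the positive `y`. The operators `2 d(-(2i+1))` do not
preserve the vacuum of the positive `y`, but they do after subtracting a quadratic expression `quad`
in the `y` (a Sugawara-type correction). The resulting operators `create` are, on the vacuum, dual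
to the positive `d` up to invertible factors. In each layer the number operator `∑ b_i a_i` shows
that a vector killed by all annihilators lies in the bottom space (`mem_of_annihilated`); together
the layers give `mem_span_ω`. Cyclicity of `ω̄` suffices for this; no freeness or
Poincaré–Birkhoff–Witt basis enters.

For an arbitrary type, the positive `y` are locally nilpotent, and so are the positive `d` on the
vacuum, so their eigenvalues on a nonzero vector vanish and `mem_span_ω` applies. Finally `R ω̄` is
spanned by the `c(-η) ω̄`, since `c(1)` is a scalar and `c(n) = 0` for `n ≥ 2`; conversely
everything in `R ω̄` has type `ψ` because `R` commutes with the action. -/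

namespace NappiWitten

/-! ### Creation and annihilation operators: the number operator argument -/

section Ladder

variable {R M ι : Type*} [CommRing R] [AddCommGroup M] [Module R M]

/-- The vectors obtained from `W` by applying at most `N` of the creation operators `b i`. -/
def ladder (b : ι → Module.End R M) (W : Submodule R M) : ℕ → Submodule R M
  | 0 => W
  | N + 1 => ladder b W N ⊔ ⨆ i, (ladder b W N).map (b i)

variable {a b : ι → Module.End R M} {W : Submodule R M}

theorem ladder_le_succ (N : ℕ) : ladder b W N ≤ ladder b W (N + 1) := le_sup_left

theorem ladder_mono : Monotone (ladder b W) := monotone_nat_of_le_succ ladder_le_succ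

theorem apply_mem_ladder_succ {N : ℕ} {f : M} (hf : f ∈ ladder b W N) (i : ι) :
    b i f ∈ ladder b W (N + 1) :=
  Submodule.mem_sup_right (Submodule.mem_iSup_of_mem i (Submodule.mem_map_of_mem hf))

theorem ladder_succ_le {N : ℕ} {S : Submodule R M} (h : ladder b W N ≤ S)
    (hb : ∀ i, ∀ f ∈ ladder b W N, b i f ∈ S) : ladder b W (N + 1) ≤ S :=
  sup_le h (iSup_le fun i => Submodule.map_le_iff_le_comap.mpr (hb i))

/-- Moving an annihilator past a creation operator either leaves it one step further down or uses up
that creation operator. The subtraction is truncated, so at `N = 0` the bound is `W` itself. -/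
theorem annihilate_mem_ladder [DecidableEq ι] (h0 : ∀ i, ∀ w ∈ W, a i w = 0)
    (h1 : ∀ i j N, ∀ f ∈ ladder b W N, a i (b j f) = b j (a i f) + if i = j then f else 0)
    (i : ι) (N : ℕ) : ∀ f ∈ ladder b W N, a i f ∈ ladder b W (N - 1) := by
  induction N with
  | zero => intro f hf; rw [h0 i f hf]; exact Submodule.zero_mem _
  | succ N ih =>
    refine ladder_succ_le (S := (ladder b W N).comap (a i))
      (fun f hf => ladder_mono (Nat.sub_le N 1) (ih f hf)) fun j f hf => ?_
    rw [Submodule.mem_comap, h1 i j N f hf]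
    refine Submodule.add_mem _ ?_ ?_
    · rcases N with _ | N
      · rw [h0 i f hf, map_zero]; exact Submodule.zero_mem _
      · exact apply_mem_ladder_succ (ih f hf) j
    · split_ifs
      · exact hf
      · exact Submodule.zero_mem _

theorem annihilate_pow_eq_zero [DecidableEq ι] (h0 : ∀ i, ∀ w ∈ W, a i w = 0)
    (h1 : ∀ i j N, ∀ f ∈ ladder b W N, a i (b j f) = b j (a i f) + if i = j then f else 0)
    (i : ι) (N : ℕ) : ∀ f ∈ ladder b W N, (a i ^ (N + 1)) f = 0 := by
  induction N with
  | zero => intro f hf; rw [zero_add, pow_one]; exact h0 i f hf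
  | succ N ih =>
    intro f hf
    rw [pow_succ, Module.End.mul_apply]
    exact ih _ (annihilate_mem_ladder h0 h1 i (N + 1) f hf)

/-- The number operator `∑ i, b i ∘ a i` acts on the `N`-th step of the ladder as `N`, up to the
preceding step. -/
theorem number_operator [DecidableEq ι] (h0 : ∀ i, ∀ w ∈ W, a i w = 0)
    (h1 : ∀ i j N, ∀ f ∈ ladder b W N, a i (b j f) = b j (a i f) + if i = j then f else 0)
    (h2 : ∀ i j N, ∀ f ∈ ladder b W N, b i (b j f) - b j (b i f) ∈ ladder b W N)
    (N : ℕ) : ∀ f ∈ ladder b W N, ∃ S : Finset ι, ∀ T, S ⊆ T →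
      ∑ i ∈ T, b i (a i f) - (N : R) • f ∈ ladder b W (N - 1) := by
  induction N with
  | zero =>
    intro f hf
    refine ⟨∅, fun T _ => ?_⟩
    rw [Finset.sum_eq_zero fun i _ => by rw [h0 i f hf, map_zero]]
    simp
  | succ N ih =>
    let P : Submodule R M :=
      { carrier := {f | ∃ S : Finset ι, ∀ T, S ⊆ T →
          ∑ i ∈ T, b i (a i f) - ((N + 1 : ℕ) : R) • f ∈ ladder b W N}
        zero_mem' := ⟨∅, fun T _ => by simp⟩
        add_mem' := by
          rintro f g ⟨S, hS⟩ ⟨S', hS'⟩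
          refine ⟨S ∪ S', fun T hT => ?_⟩
          have := Submodule.add_mem _ (hS T (Finset.union_subset_left hT))
            (hS' T (Finset.union_subset_right hT))
          convert this using 1
          simp only [map_add, Finset.sum_add_distrib, smul_add]
          abel
        smul_mem' := by
          rintro r f ⟨S, hS⟩
          refine ⟨S, fun T hT => ?_⟩
          convert Submodule.smul_mem _ r (hS T hT) using 1
          simp only [map_smul, smul_sub, Finset.smul_sum, smul_comm r] }
    suffices h : ladder b W (N + 1) ≤ P from fun f hf => h hf
    refine ladder_succ_le (fun f hf => ?_) fun j f hf => ?_
    · obtain ⟨S, hS⟩ := ih f hf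
      refine ⟨S, fun T hT => ?_⟩
      convert Submodule.sub_mem _ (ladder_mono (Nat.sub_le N 1) (hS T hT)) hf using 1
      push_cast
      rw [add_smul, one_smul]
      abel
    · obtain ⟨S, hS⟩ := ih f hf
      refine ⟨insert j S, fun T hT => ?_⟩
      have hj : j ∈ T := hT (Finset.mem_insert_self _ _)
      -- The Kronecker delta contributes one extra `b j f`, which raises the eigenvalue from `N` to
      -- `N + 1`. What remains is the old number operator under `b j` plus commutators of creation
      -- operators, which `h2` makes lower order.
      have e : ∑ i ∈ T, b i (a i (b j f)) - ((N + 1 : ℕ) : R) • b j f =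
          ∑ i ∈ T, (b i (b j (a i f)) - b j (b i (a i f))) +
            b j (∑ i ∈ T, b i (a i f) - (N : R) • f) := by
        have e1 : ∑ i ∈ T, b i (a i (b j f)) = ∑ i ∈ T, b i (b j (a i f)) + b j f := by
          have : ∀ i ∈ T, b i (a i (b j f)) = b i (b j (a i f)) + if i = j then b j f else 0 := by
            intro i _
            rw [h1 i j N f hf, map_add]
            split_ifs with h
            · rw [h]
            · rw [map_zero]
          rw [Finset.sum_congr rfl this, Finset.sum_add_distrib, Finset.sum_ite_eq' T j, if_pos hj]
        rw [e1, Finset.sum_sub_distrib, map_sub, map_sum, map_smul]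
        push_cast
        rw [add_smul, one_smul]
        abel
      rw [e]
      refine Submodule.add_mem _ (Submodule.sum_mem _ fun i _ => ?_) ?_
      · exact ladder_mono (Nat.sub_le N 1)
          (h2 i j (N - 1) _ (annihilate_mem_ladder h0 h1 i N f hf))
      -- At `N = 0` truncation makes `hg` too weak (`N - 1 = 0`), but there the sum vanishes
      -- exactly.
      · have hg := hS T ((Finset.subset_insert _ _).trans hT)
        rcases N with _ | N
        · rw [Finset.sum_eq_zero fun i _ => by rw [h0 i f hf, map_zero]]
          simp
        · exact apply_mem_ladder_succ hg j

/-- A vector of the ladder that is killed by all annihilation operators lies in the vacuum space. -/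
theorem mem_of_annihilated [DecidableEq ι] (hR : ∀ n : ℕ, n ≠ 0 → IsUnit (n : R))
    (h0 : ∀ i, ∀ w ∈ W, a i w = 0)
    (h1 : ∀ i j N, ∀ f ∈ ladder b W N, a i (b j f) = b j (a i f) + if i = j then f else 0)
    (h2 : ∀ i j N, ∀ f ∈ ladder b W N, b i (b j f) - b j (b i f) ∈ ladder b W N)
    {N : ℕ} {v : M} (hv : v ∈ ladder b W N) (ha : ∀ i, a i v = 0) : v ∈ W := by
  induction N with
  | zero => exact hv
  | succ N ih =>
    obtain ⟨S, hS⟩ := number_operator h0 h1 h2 (N + 1) v hv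
    have h := hS S (Finset.Subset.refl S)
    -- The number operator kills `v`, so `(N + 1) • v` lies one step lower; dividing by the unit `N
    -- + 1` lets the induction descend.
    rw [Finset.sum_eq_zero fun i _ => by rw [ha i, map_zero], zero_sub, Submodule.neg_mem_iff] at h
    exact ih ((Submodule.smul_mem_iff_of_isUnit _ (hR (N + 1) N.succ_ne_zero)).mp h)

theorem mem_iSup_ladder {v : M} : v ∈ ⨆ N, ladder b W N ↔ ∃ N, v ∈ ladder b W N :=
  Submodule.mem_iSup_of_directed _ ladder_mono.directed_le

theorem apply_mem_iSup_ladder {v : M} (hv : v ∈ ⨆ N, ladder b W N) (i : ι) :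
    b i v ∈ ⨆ N, ladder b W N := by
  obtain ⟨N, hN⟩ := mem_iSup_ladder.mp hv
  exact mem_iSup_ladder.mpr ⟨N + 1, apply_mem_ladder_succ hN i⟩

theorem iSup_ladder_le {S : Submodule R M} (hW : W ≤ S)
    (hb : ∀ i, ∀ f ∈ ⨆ N, ladder b W N, f ∈ S → b i f ∈ S) : ⨆ N, ladder b W N ≤ S := by
  refine iSup_le fun N => ?_
  induction N with
  | zero => exact hW
  | succ N ih =>
    exact ladder_succ_le ih fun i f hf => hb i f (mem_iSup_ladder.mpr ⟨N, hf⟩) (ih hf)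

end Ladder
end NappiWitten

/-! ### Abstract twisted action: dual operators and the quadratic correction -/

noncomputable section
namespace NappiWitten

/-- The sign `(-1)ᵐ` in a commutative ring. -/
def sgn (R : Type*) [CommRing R] (m : ℤ) : R := ((m.negOnePow : ℤ) : R)

section Sign

variable {R : Type*} [CommRing R]

theorem sgn_add (m n : ℤ) : sgn R (m + n) = sgn R m * sgn R n := by
  simp [sgn, Int.negOnePow_add]

theorem sgn_of_even {m : ℤ} (h : Even m) : sgn R m = 1 := by
  simp [sgn, Int.negOnePow_even m h]

theorem sgn_of_odd {m : ℤ} (h : Odd m) : sgn R m = -1 := by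
  simp [sgn, Int.negOnePow_odd m h]

theorem sgn_mul_self (m : ℤ) : sgn R m * sgn R m = 1 := by
  rw [← sgn_add, sgn_of_even ⟨m, rfl⟩]

theorem sgn_neg (m : ℤ) : sgn R (-m) = sgn R m := by
  simp [sgn, Int.negOnePow_neg]

end Sign

/-- Operators `y n` and `d m` on an `R`-module `M` satisfying the relations of a twisted Nappi-Witten
algebra of level zero, whose central modes act through the ring `R`, with a generating vector `ω`
that is killed by all positive modes. Only the `d m` with `m` odd are meaningful. -/
structure TwistedAction (R M : Type*) [CommRing R] [AddCommGroup M] [Module R M] where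
  c : ℤ → R
  y : ℤ → Module.End R M
  d : ℤ → Module.End R M
  ω : M
  isUnit_natCast : ∀ n : ℕ, n ≠ 0 → IsUnit (n : R)
  isUnit_c_one : IsUnit (c 1)
  c_of_one_lt : ∀ n, 1 < n → c n = 0
  c_of_even : ∀ n, Even n → c n = 0
  y_y : ∀ m n f, y m (y n f) = y n (y m f) + (sgn R m * c (m + n)) • f
  d_y : ∀ m n f, Odd m → d m (y n f) = y n (d m f) + y (m + n) f
  d_d : ∀ m n f, Odd m → Odd n → d m (d n f) = d n (d m f)
  y_ω : ∀ n, 1 ≤ n → y n ω = 0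
  d_ω : ∀ n, Odd n → 1 ≤ n → d n ω = 0
  cyclic : ∀ S : Submodule R M, ω ∈ S → (∀ n, ∀ f ∈ S, y n f ∈ S) →
    (∀ n, Odd n → ∀ f ∈ S, d n f ∈ S) → S = ⊤

namespace TwistedAction

variable {R M : Type*} [CommRing R] [AddCommGroup M] [Module R M] (A : TwistedAction R M)

/-- The coefficients of the inverse of the power series `∑ c(1 - k) sᵏ`. -/
def u (k : ℕ) : R :=
  PowerSeries.coeff k (PowerSeries.invOfUnit (PowerSeries.mk fun k : ℕ => A.c (1 - k))
    A.isUnit_c_one.unit)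

theorem sum_antidiagonal_u_mul_c (N : ℕ) :
    ∑ x ∈ Finset.HasAntidiagonal.antidiagonal N, A.u x.1 * A.c (1 - (x.2 : ℤ)) = if N = 0 then 1 else 0 := by
  have h := PowerSeries.mul_invOfUnit (PowerSeries.mk fun k : ℕ => A.c (1 - k))
    A.isUnit_c_one.unit (by simp)
  rw [mul_comm] at h
  have h2 := congrArg (PowerSeries.coeff N) h
  rw [PowerSeries.coeff_mul, PowerSeries.coeff_one] at h2
  simp only [PowerSeries.coeff_mk] at h2
  exact h2

/-- The inverse power series in the form in which it inverts the triangular matrix of brackets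
between the `y n`, `n ≥ 1`, and the `y m`, `m ≤ 0`. -/
theorem sum_u_mul_c (p : ℕ) {t : ℤ} (ht : 1 ≤ t) :
    ∑ k ∈ Finset.range (p + 1), A.u k * A.c (t - p + k) = if t = p + 1 then 1 else 0 := by
  by_cases h : t ≤ p + 1
  · obtain ⟨N, hN⟩ := Int.eq_ofNat_of_zero_le (sub_nonneg.mpr h)
    have e := A.sum_antidiagonal_u_mul_c N
    rw [Finset.Nat.sum_antidiagonal_eq_sum_range_succ_mk] at e
    -- With `N = p + 1 - t`, the terms with `k > N` involve `c` at an index above `1` and vanish.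
    rw [← Finset.sum_subset (Finset.range_mono (show N + 1 ≤ p + 1 by omega))]
    · rw [show (if t = p + 1 then (1 : R) else 0) = if N = 0 then 1 else 0 by
        simp only [show t = p + 1 ↔ N = 0 by omega], ← e]
      refine Finset.sum_congr rfl fun k hk => ?_
      rw [Finset.mem_range] at hk
      congr 2
      push_cast [Nat.cast_sub (show k ≤ N by omega)]
      omega
    · intro k _ hk
      rw [Finset.mem_range] at hk
      rw [A.c_of_one_lt _ (by omega), mul_zero]
  · rw [if_neg (by omega)]
    exact Finset.sum_eq_zero fun k _ => by rw [A.c_of_one_lt _ (by omega), mul_zero]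

theorem isUnit_u_zero : IsUnit (A.u 0) := by
  have h := A.sum_u_mul_c 0 le_rfl
  simp only [zero_add, Finset.sum_range_one, Nat.cast_zero, if_true] at h
  exact IsUnit.of_mul_eq_one _ h

/-- The creation operators dual to the `y n`, `n ≥ 1`. -/
def hat (p : ℕ) : Module.End R M := ∑ k ∈ Finset.range (p + 1), A.u k • A.y (k - p)

theorem hat_apply (p : ℕ) (f : M) :
    A.hat p f = ∑ k ∈ Finset.range (p + 1), A.u k • A.y (k - p) f := by
  simp [hat, LinearMap.sum_apply]

theorem y_hat {n : ℤ} (hn : 1 ≤ n) (p : ℕ) (f : M) :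
    A.y n (A.hat p f) = A.hat p (A.y n f) + if n = p + 1 then sgn R n • f else 0 := by
  have h : (if n = p + 1 then sgn R n • f else 0) =
      (sgn R n * ∑ k ∈ Finset.range (p + 1), A.u k * A.c (n - p + k)) • f := by
    rw [A.sum_u_mul_c p hn]
    split_ifs <;> simp
  rw [h, hat_apply, hat_apply, map_sum, Finset.mul_sum, Finset.sum_smul, ← Finset.sum_add_distrib]
  refine Finset.sum_congr rfl fun k _ => ?_
  rw [map_smul, A.y_y, smul_add, smul_smul, show n - p + k = n + (k - p) by ring]
  congr 2
  ring

theorem d_hat {n : ℤ} (hn : Odd n) (p : ℕ) (f : M) :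
    A.d n (A.hat p f) = A.hat p (A.d n f) +
      ∑ k ∈ Finset.range (p + 1), A.u k • A.y (n - p + k) f := by
  rw [hat_apply, hat_apply, map_sum, ← Finset.sum_add_distrib]
  refine Finset.sum_congr rfl fun k _ => ?_
  rw [map_smul, A.d_y _ _ _ hn, smul_add, show n - p + k = n + (k - p) by ring]

/-- The quadratic expression whose bracket with the `y n` agrees, on vacuum vectors, with that of
`2 d (-(q + 1))`. -/
def quad (q : ℕ) : Module.End R M :=
  ∑ p ∈ Finset.range (q + 1), sgn R p • (A.hat p ∘ₗ A.y (p - q))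

theorem quad_apply (q : ℕ) (f : M) :
    A.quad q f = ∑ p ∈ Finset.range (q + 1), sgn R p • A.hat p (A.y (p - q) f) := by
  simp [quad, LinearMap.sum_apply]

/-- Bracketing with `d n` shifts one index of each quadratic term, so the result is again quadratic
in the `y`, with no `d` left over. -/
theorem d_quad {n : ℤ} (hn : Odd n) (q : ℕ) (f : M) :
    A.d n (A.quad q f) = A.quad q (A.d n f) +
      ∑ p ∈ Finset.range (q + 1), sgn R p • ∑ k ∈ Finset.range (p + 1),
        A.u k • (A.y (n - p + k) (A.y (p - q) f) + A.y (k - p) (A.y (n + p - q) f)) := by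
  rw [quad_apply, quad_apply, map_sum, ← Finset.sum_add_distrib]
  refine Finset.sum_congr rfl fun p _ => ?_
  rw [map_smul, A.d_hat hn, A.d_y _ _ _ hn, map_add, ← smul_add,
    show n + (p - q) = n + p - q by ring, A.hat_apply p (A.y (n + p - q) f), add_assoc,
    ← Finset.sum_add_distrib]
  simp only [smul_add, add_comm]

theorem sum_range_sum_range (G : ℕ → ℕ → M) (q : ℕ) :
    ∑ p ∈ Finset.range (q + 1), ∑ k ∈ Finset.range (p + 1), G p k =
      ∑ k ∈ Finset.range (q + 1), ∑ r ∈ Finset.range (q - k + 1), G (r + k) k := by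
  rw [Finset.sum_sigma', Finset.sum_sigma']
  refine Finset.sum_bij' (fun x _ => ⟨x.2, x.1 - x.2⟩) (fun x _ => ⟨x.2 + x.1, x.1⟩) ?_ ?_ ?_ ?_ ?_
  · rintro ⟨p, k⟩ h
    simp only [Finset.mem_sigma, Finset.mem_range] at h ⊢
    omega
  · rintro ⟨k, r⟩ h
    simp only [Finset.mem_sigma, Finset.mem_range] at h ⊢
    omega
  · rintro ⟨p, k⟩ h
    simp only [Finset.mem_sigma, Finset.mem_range] at h
    simp only [Sigma.mk.injEq, heq_eq_eq, and_true]
    omega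
  · rintro ⟨k, r⟩ h
    simp
  · rintro ⟨p, k⟩ h
    simp only [Finset.mem_sigma, Finset.mem_range] at h
    simp only
    rw [Nat.sub_add_cancel (by omega)]

theorem sum_range_sum_range_comm (G : ℕ → ℕ → M) (q : ℕ) :
    ∑ k ∈ Finset.range (q + 1), ∑ r ∈ Finset.range (q - k + 1), G r k =
      ∑ r ∈ Finset.range (q + 1), ∑ k ∈ Finset.range (q - r + 1), G r k := by
  refine Finset.sum_comm' fun k r => ?_
  simp only [Finset.mem_range]
  omega

/-- Two sums of `g` over windows that are translates by `n`: the overlap cancels and `n` boundary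
terms survive at each end. -/
theorem sum_range_shift_sub (g : ℤ → M) (L n : ℕ) :
    ∑ r ∈ Finset.range (L + 1), (g (-r) - g (n - r)) =
      ∑ j ∈ Finset.range n, g (j - L) - ∑ j ∈ Finset.range n, g (1 + j) := by
  induction n with
  | zero => simp
  | succ n ih =>
    have h : ∑ r ∈ Finset.range (L + 1), (g (n - r) - g ((n + 1 : ℕ) - r)) =
        g (n - L) - g (1 + n) := by
      clear ih
      induction L with
      | zero => simp [add_comm]
      | succ L ih =>
        rw [Finset.sum_range_succ, ih]
        push_cast
        rw [show (n : ℤ) + 1 - (L + 1) = n - L by ring]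
        abel
    have e : ∀ r ∈ Finset.range (L + 1), g (-r) - g ((n + 1 : ℕ) - r) =
        (g (-r) - g (n - r)) + (g (n - r) - g ((n + 1 : ℕ) - r)) := fun r _ => by abel
    rw [Finset.sum_congr rfl e, Finset.sum_add_distrib, ih, h, Finset.sum_range_succ,
      Finset.sum_range_succ]
    abel

/-- The vectors killed by all `y n` with `n ≥ 1`. -/
def vacuum : Submodule R M := ⨅ n : ℕ, LinearMap.ker (A.y (n + 1))

variable {A}

theorem mem_vacuum {w : M} : w ∈ A.vacuum ↔ ∀ n : ℤ, 1 ≤ n → A.y n w = 0 := by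
  simp only [vacuum, Submodule.mem_iInf, LinearMap.mem_ker]
  refine ⟨fun h n hn => ?_, fun h n => h _ (by omega)⟩
  obtain ⟨k, hk⟩ := Int.eq_ofNat_of_zero_le (show 0 ≤ n - 1 by omega)
  rw [show n = k + 1 by omega]
  exact h k

variable (A)

/-- Two equal contributions make up the `-2`. The bracket of `y n` with `hat p` singles out `p = n -
1`; the brackets of `y n` with the `y (p - q)` yield scalars `c (n + p - q)`, and the sum of the
`hat p` with these coefficients is `y (n - 1 - q)`, by duality. -/
theorem y_quad {n : ℤ} (hn : 1 ≤ n) {q : ℕ} (hq : Even q) {w : M} (hw : w ∈ A.vacuum) :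
    A.y n (A.quad q w) = (-2 : R) • A.y (n - 1 - q) w := by
  have hw := mem_vacuum.mp hw
  have hq' : Even (q : ℤ) := (Int.even_coe_nat q).mpr hq
  have e : ∀ p ∈ Finset.range (q + 1), A.y n (sgn R p • A.hat p (A.y (p - q) w)) =
      (if n = p + 1 then -A.y (p - q) w else 0) - A.c (n + p - q) • A.hat p w := by
    intro p _
    rw [map_smul, A.y_hat hn, A.y_y, hw n hn, map_zero, zero_add, map_smul, smul_add, smul_smul,
      add_comm, sub_eq_add_neg (ite _ _ _)]
    congr 1
    · split_ifs with h
      · rw [smul_smul, h, sgn_add, ← mul_assoc, sgn_mul_self, sgn_of_odd odd_one]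
        simp
      · exact smul_zero _
    · rw [show n + (p - q) = n + p - q by ring, ← mul_assoc, ← sgn_add, ← neg_smul]
      congr 1
      -- As `c` vanishes at even indices, only odd `n + p - q` matters; then `q` even forces the
      -- sign `(-1)^(n+p)` to be `-1`.
      rcases Int.even_or_odd (n + p - q) with h | h
      · rw [A.c_of_even _ h]; simp
      · rw [sgn_of_odd (by rw [add_comm, ← sub_add_cancel (n + p) (q : ℤ)]; exact h.add_even hq')]
        ring
  rw [quad_apply, map_sum, Finset.sum_congr rfl e, Finset.sum_sub_distrib]
  have e1 : ∑ p ∈ Finset.range (q + 1), (if n = p + 1 then -A.y (p - q) w else 0) =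
      -A.y (n - 1 - q) w := by
    by_cases h : n ≤ q + 1
    · obtain ⟨k, hk⟩ := Int.eq_ofNat_of_zero_le (show 0 ≤ n - 1 by omega)
      rw [Finset.sum_eq_single_of_mem k (Finset.mem_range.mpr (by omega)), if_pos (by omega), hk]
      intro p _ hp
      rw [if_neg (by omega)]
    · rw [hw _ (by omega), neg_zero]
      refine Finset.sum_eq_zero fun p hp => ?_
      rw [Finset.mem_range] at hp
      rw [if_neg (by omega)]
  have e2 : ∑ p ∈ Finset.range (q + 1), A.c (n + p - q) • A.hat p w = A.y (n - 1 - q) w := by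
    simp only [hat_apply, Finset.smul_sum]
    rw [sum_range_sum_range, sum_range_sum_range_comm
      (fun r k => A.c (n + (r + k : ℕ) - q) • A.u k • A.y (k - (r + k : ℕ)) w)]
    have e3 : ∀ r ∈ Finset.range (q + 1), ∑ k ∈ Finset.range (q - r + 1),
        A.c (n + (r + k : ℕ) - q) • A.u k • A.y (k - (r + k : ℕ)) w =
        if n = (q - r : ℕ) + 1 then A.y (-r) w else 0 := by
      intro r hr
      rw [Finset.mem_range] at hr
      have : ∀ k ∈ Finset.range (q - r + 1),
          A.c (n + (r + k : ℕ) - q) • A.u k • A.y (k - (r + k : ℕ)) w =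
          (A.u k * A.c (n - (q - r : ℕ) + k)) • A.y (-r) w := by
        intro k _
        rw [smul_smul, mul_comm]
        congr 3
        · push_cast [Nat.cast_sub (show r ≤ q by omega)]; ring
        · push_cast; ring_nf
      rw [Finset.sum_congr rfl this, ← Finset.sum_smul, A.sum_u_mul_c _ hn]
      split_ifs <;> simp
    rw [Finset.sum_congr rfl e3]
    by_cases h : n ≤ q + 1
    · obtain ⟨k, hk⟩ := Int.eq_ofNat_of_zero_le (show 0 ≤ q + 1 - n by omega)
      rw [Finset.sum_eq_single_of_mem k (Finset.mem_range.mpr (by omega)), if_pos (by omega)]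
      · congr 2; omega
      · intro p hp hp'
        rw [Finset.mem_range] at hp
        rw [if_neg (by omega)]
    · rw [hw _ (by omega)]
      refine Finset.sum_eq_zero fun p hp => ?_
      rw [Finset.mem_range] at hp
      rw [if_neg (by omega)]
  rw [e1, e2]
  module

/-- For each fixed `k` the terms of `d_quad` telescope. On a vacuum vector one end vanishes and the
other gives `n` equal scalars `c (n - q + k)`, which the inverse series then sums to a Kronecker
delta. -/
theorem d_quad_vacuum {n : ℕ} (hn : Odd n) {q : ℕ} (hq : Even q) {w : M} (hw : w ∈ A.vacuum) :
    A.d n (A.quad q w) = A.quad q (A.d n w) - if n = q + 1 then (n : R) • w else 0 := by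
  have hw := mem_vacuum.mp hw
  have hq' : Even (q : ℤ) := (Int.even_coe_nat q).mpr hq
  have hn' : Odd (n : ℤ) := (Int.odd_coe_nat n).mpr hn
  rw [A.d_quad hn', sub_eq_add_neg]
  congr 1
  simp only [Finset.smul_sum]
  rw [sum_range_sum_range]
  have e : ∀ k ∈ Finset.range (q + 1), ∑ r ∈ Finset.range (q - k + 1),
      sgn R (r + k : ℕ) • A.u k • (A.y (n - (r + k : ℕ) + k) (A.y ((r + k : ℕ) - q) w) +
        A.y (k - (r + k : ℕ)) (A.y (n + (r + k : ℕ) - q) w)) =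
      (A.u k * A.c (n - q + k)) • -((n : R) • w) := by
    intro k hk
    rw [Finset.mem_range] at hk
    -- The two summands of `d_quad` are values of this one function at `-r` and `n - r`; the minus
    -- sign between them comes from `n` being odd.
    let g : ℤ → M := fun a => sgn R a • A.y a (A.y (n - q + k - a) w)
    have e1 : ∀ r ∈ Finset.range (q - k + 1),
        sgn R (r + k : ℕ) • A.u k • (A.y (n - (r + k : ℕ) + k) (A.y ((r + k : ℕ) - q) w) +
        A.y (k - (r + k : ℕ)) (A.y (n + (r + k : ℕ) - q) w)) =
        (sgn R k * A.u k) • (g (-r) - g (n - r)) := by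
      intro r _
      simp only [g]
      rw [show ((n : ℤ) - (r + k : ℕ) + k) = n - r by push_cast; ring,
        show (((r + k : ℕ) : ℤ) - q) = n - q + k - (n - r) by push_cast; ring,
        show ((k : ℤ) - (r + k : ℕ)) = -r by push_cast; ring,
        show ((n : ℤ) + (r + k : ℕ) - q) = n - q + k - -r by push_cast; ring,
        sub_eq_add_neg (n : ℤ) r, sgn_add (n : ℤ), sgn_of_odd hn', sgn_neg, Nat.cast_add, sgn_add]
      module
    have e2 : ∀ j ∈ Finset.range n, g (j - (q - k : ℕ)) = 0 := by
      intro j hj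
      rw [Finset.mem_range] at hj
      simp only [g]
      rw [hw _ (by push_cast [Nat.cast_sub (show k ≤ q by omega)]; omega), map_zero, smul_zero]
    have e3 : ∀ j ∈ Finset.range n, g (1 + j) = A.c (n - q + k) • w := by
      intro j _
      simp only [g]
      rw [A.y_y, hw _ (by omega), map_zero, zero_add, smul_smul, ← mul_assoc, sgn_mul_self, one_mul,
        add_sub_cancel]
    rw [Finset.sum_congr rfl e1, ← Finset.smul_sum, sum_range_shift_sub, Finset.sum_eq_zero e2,
      Finset.sum_congr rfl e3, Finset.sum_const, Finset.card_range, zero_sub, ← Nat.cast_smul_eq_nsmul R,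
      smul_comm (n : R), ← smul_neg, smul_smul]
    congr 1
    -- The leftover sign `(-1)^k` is harmless: for `k` odd, `n - q + k` is even and `c` vanishes
    -- there.
    rcases Nat.even_or_odd k with h | h
    · rw [sgn_of_even ((Int.even_coe_nat k).mpr h), one_mul]
    · rw [A.c_of_even _ ((hn'.sub_even hq').add_odd ((Int.odd_coe_nat k).mpr h))]
      simp
  rw [Finset.sum_congr rfl e, ← Finset.sum_smul, A.sum_u_mul_c q (by have := hn.pos; omega)]
  by_cases h : n = q + 1
  · rw [if_pos h, if_pos (by omega), one_smul]
  · rw [if_neg h, if_neg (by omega), zero_smul, neg_zero]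

end TwistedAction
end NappiWitten
end

/-! ### The two Fock layers: vacuum of the `y`, then vacuum of the `d` -/

noncomputable section
namespace NappiWitten
namespace TwistedAction

variable {R M : Type*} [CommRing R] [AddCommGroup M] [Module R M] (A : TwistedAction R M)

/-- The annihilation operators dual to `hat`. -/
def annihilate (i : ℕ) : Module.End R M := sgn R (i + 1 : ℕ) • A.y (i + 1 : ℕ)

theorem annihilate_hat (i j : ℕ) (f : M) :
    A.annihilate i (A.hat j f) = A.hat j (A.annihilate i f) + if i = j then f else 0 := by
  simp only [annihilate, LinearMap.smul_apply]
  rw [A.y_hat (by omega), smul_add, map_smul]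
  congr 1
  by_cases h : i = j
  · rw [if_pos h, if_pos (by omega), smul_smul, sgn_mul_self, one_smul]
  · rw [if_neg h, if_neg (by omega), smul_zero]

variable {A}

theorem annihilate_eq_zero {w : M} (hw : w ∈ A.vacuum) (i : ℕ) : A.annihilate i w = 0 := by
  rw [annihilate, LinearMap.smul_apply, mem_vacuum.mp hw _ (by omega), smul_zero]

variable (A)

theorem hat_hat_sub (i j : ℕ) : ∃ r : R, ∀ f, A.hat i (A.hat j f) - A.hat j (A.hat i f) = r • f := by
  refine ⟨∑ k ∈ Finset.range (i + 1), ∑ l ∈ Finset.range (j + 1),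
    A.u k * (A.u l * (sgn R (k - i) * A.c (k - i + (l - j)))), fun f => ?_⟩
  simp only [hat_apply, map_sum, map_smul, Finset.smul_sum, Finset.sum_smul]
  rw [Finset.sum_comm (s := Finset.range (j + 1)), ← Finset.sum_sub_distrib]
  refine Finset.sum_congr rfl fun k _ => ?_
  rw [← Finset.sum_sub_distrib]
  refine Finset.sum_congr rfl fun l _ => ?_
  rw [A.y_y (k - i) (l - j)]
  module

/-- The `R`-submodule generated from `W` by the operators `y n`, `n ≤ 0`. -/
def ySpan (W : Submodule R M) : Submodule R M := ⨆ N, ladder A.hat W N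

theorem le_ySpan (W : Submodule R M) : W ≤ A.ySpan W := le_iSup (ladder A.hat W) 0

/-- First use of the number operator: the `hat` commute up to scalars of `R`, so the ladder built on
`W` meets the vacuum only in `W`. -/
theorem mem_of_mem_ySpan {W : Submodule R M} (hW : W ≤ A.vacuum) {v : M} (hv : v ∈ A.ySpan W)
    (h : v ∈ A.vacuum) : v ∈ W := by
  obtain ⟨N, hN⟩ := mem_iSup_ladder.mp hv
  refine mem_of_annihilated A.isUnit_natCast (fun i w hw => annihilate_eq_zero (hW hw) i)
    (fun i j _ f _ => A.annihilate_hat i j f) (fun i j N f hf => ?_) hN (annihilate_eq_zero h)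
  obtain ⟨r, hr⟩ := A.hat_hat_sub i j
  rw [hr]
  exact Submodule.smul_mem _ _ hf

/-- `hat p` is `u 0 • y (-p)` plus operators `y (-p')` with `p' < p`, and `u 0` is a unit, so the
triangular change of operators can be undone. -/
theorem y_nonpos_mem_ySpan {W : Submodule R M} (p : ℕ) :
    ∀ f ∈ A.ySpan W, A.y (-p) f ∈ A.ySpan W := by
  induction p using Nat.strong_induction_on with
  | _ p ih =>
    intro f hf
    have h : A.hat p f ∈ A.ySpan W := apply_mem_iSup_ladder hf p
    rw [hat_apply, Finset.sum_range_succ', Submodule.add_mem_iff_right] at h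
    · rw [Nat.cast_zero, zero_sub] at h
      exact (Submodule.smul_mem_iff_of_isUnit _ A.isUnit_u_zero).mp h
    · refine Submodule.sum_mem _ fun k hk => Submodule.smul_mem _ _ ?_
      rw [Finset.mem_range] at hk
      rw [show ((k + 1 : ℕ) - p : ℤ) = -(p - (k + 1) : ℕ) by omega]
      exact ih _ (by omega) f hf

theorem y_mem_ySpan {W : Submodule R M} (hW : W ≤ A.vacuum) (n : ℤ) :
    ∀ f ∈ A.ySpan W, A.y n f ∈ A.ySpan W := by
  rcases le_or_gt n 0 with h | h
  · obtain ⟨p, rfl⟩ := Int.exists_eq_neg_ofNat h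
    exact A.y_nonpos_mem_ySpan p
  · refine iSup_ladder_le (S := (A.ySpan W).comap (A.y n)) (fun w hw => ?_) fun p f hf hf' => ?_
    · rw [Submodule.mem_comap, mem_vacuum.mp (hW hw) n h]
      exact Submodule.zero_mem _
    · rw [Submodule.mem_comap, A.y_hat h]
      refine Submodule.add_mem _ (apply_mem_iSup_ladder hf' p) ?_
      split_ifs
      · exact Submodule.smul_mem _ _ hf
      · exact Submodule.zero_mem _

theorem hat_mem_ySpan {W : Submodule R M} (p : ℕ) {f : M} (hf : f ∈ A.ySpan W) :
    A.hat p f ∈ A.ySpan W := apply_mem_iSup_ladder hf p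

theorem quad_mem_ySpan {W : Submodule R M} (hW : W ≤ A.vacuum) (q : ℕ) {f : M}
    (hf : f ∈ A.ySpan W) : A.quad q f ∈ A.ySpan W := by
  rw [quad_apply]
  exact Submodule.sum_mem _ fun p _ => Submodule.smul_mem _ _
    (A.hat_mem_ySpan p (A.y_mem_ySpan hW _ f hf))

theorem d_quad_sub_mem_ySpan {W : Submodule R M} (hW : W ≤ A.vacuum) {n : ℤ} (hn : Odd n) (q : ℕ)
    {f : M} (hf : f ∈ A.ySpan W) : A.d n (A.quad q f) - A.quad q (A.d n f) ∈ A.ySpan W := by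
  rw [A.d_quad hn, add_sub_cancel_left]
  exact Submodule.sum_mem _ fun p _ => Submodule.smul_mem _ _ <| Submodule.sum_mem _ fun k _ =>
    Submodule.smul_mem _ _ <| Submodule.add_mem _
      (A.y_mem_ySpan hW _ _ (A.y_mem_ySpan hW _ _ hf))
      (A.y_mem_ySpan hW _ _ (A.y_mem_ySpan hW _ _ hf))

/-- The creation operators on the vacuum space, `2 d (-(2i + 1))` with a quadratic correction. -/
def create (i : ℕ) : Module.End R M := (2 : R) • A.d (-(2 * i + 1 : ℕ)) - A.quad (2 * i)

theorem create_apply (i : ℕ) (f : M) :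
    A.create i f = (2 : R) • A.d (-(2 * i + 1 : ℕ)) f - A.quad (2 * i) f := rfl

theorem odd_neg_cast (i : ℕ) : Odd (-(2 * i + 1 : ℕ) : ℤ) :=
  ((Int.odd_coe_nat _).mpr (odd_two_mul_add_one i)).neg

/-- On a vacuum vector `y n` sends both `2 d(-(2i+1)) w` and `quad (2i) w` to `-2 y(n - 1 - 2i) w`,
so the difference is killed. -/
theorem create_mem_vacuum (i : ℕ) {w : M} (hw : w ∈ A.vacuum) : A.create i w ∈ A.vacuum := by
  have hw' := mem_vacuum.mp hw
  refine mem_vacuum.mpr fun n hn => ?_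
  have e := A.d_y (-(2 * i + 1 : ℕ)) n w (odd_neg_cast i)
  rw [hw' n hn, map_zero] at e
  rw [create_apply, map_sub, map_smul, A.y_quad hn (even_two_mul i) hw, eq_neg_of_add_eq_zero_left e.symm,
    show -((2 * i + 1 : ℕ) : ℤ) + n = n - 1 - (2 * i : ℕ) by push_cast; ring]
  module

/-- No commutator is computed: it maps `w` into the vacuum, and it is also polynomial in the `y`
because the `d` commute among themselves. The number operator then forces the result into `R w`. -/
theorem create_create_sub_mem (i j : ℕ) {w : M} (hw : w ∈ A.vacuum) :
    A.create i (A.create j w) - A.create j (A.create i w) ∈ Submodule.span R {w} := by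
  have hW : Submodule.span R {w} ≤ A.vacuum := by simpa using hw
  have hw' : w ∈ A.ySpan (Submodule.span R {w}) :=
    A.le_ySpan _ (Submodule.mem_span_singleton_self w)
  refine A.mem_of_mem_ySpan hW ?_ (Submodule.sub_mem _
    (A.create_mem_vacuum i (A.create_mem_vacuum j hw))
    (A.create_mem_vacuum j (A.create_mem_vacuum i hw)))
  have e : A.create i (A.create j w) - A.create j (A.create i w) =
      (2 : R) • (A.d (-(2 * j + 1 : ℕ)) (A.quad (2 * i) w) -
        A.quad (2 * i) (A.d (-(2 * j + 1 : ℕ)) w)) -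
      (2 : R) • (A.d (-(2 * i + 1 : ℕ)) (A.quad (2 * j) w) -
        A.quad (2 * j) (A.d (-(2 * i + 1 : ℕ)) w)) +
      (A.quad (2 * i) (A.quad (2 * j) w) - A.quad (2 * j) (A.quad (2 * i) w)) := by
    simp only [create_apply, map_sub, map_smul]
    rw [A.d_d _ _ w (odd_neg_cast i) (odd_neg_cast j)]
    module
  rw [e]
  refine Submodule.add_mem _ (Submodule.sub_mem _ ?_ ?_) (Submodule.sub_mem _ ?_ ?_)
  · exact Submodule.smul_mem _ _ (A.d_quad_sub_mem_ySpan hW (odd_neg_cast j) _ hw')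
  · exact Submodule.smul_mem _ _ (A.d_quad_sub_mem_ySpan hW (odd_neg_cast i) _ hw')
  · exact A.quad_mem_ySpan hW _ (A.quad_mem_ySpan hW _ hw')
  · exact A.quad_mem_ySpan hW _ (A.quad_mem_ySpan hW _ hw')

theorem d_create {n : ℕ} (hn : Odd n) (i : ℕ) {w : M} (hw : w ∈ A.vacuum) :
    A.d n (A.create i w) = A.create i (A.d n w) + if n = 2 * i + 1 then (n : R) • w else 0 := by
  rw [create_apply, create_apply, map_sub, map_smul, A.d_quad_vacuum hn (even_two_mul i) hw,
    A.d_d _ _ w ((Int.odd_coe_nat n).mpr hn) (odd_neg_cast i)]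
  abel

/-- The vectors obtained from `ω` by the operators `create`. -/
def dSpan : Submodule R M := ⨆ N, ladder A.create (Submodule.span R {A.ω}) N

theorem ladder_create_le_vacuum (N : ℕ) :
    ladder A.create (Submodule.span R {A.ω}) N ≤ A.vacuum := by
  induction N with
  | zero => simpa [ladder, mem_vacuum] using A.y_ω
  | succ N ih => exact ladder_succ_le ih fun i f hf => A.create_mem_vacuum i (ih hf)

theorem dSpan_le_vacuum : A.dSpan ≤ A.vacuum := iSup_le A.ladder_create_le_vacuum

theorem ω_mem_dSpan : A.ω ∈ A.dSpan :=
  le_iSup (ladder A.create (Submodule.span R {A.ω})) 0 (Submodule.mem_span_singleton_self A.ω)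

theorem d_mem_dSpan {n : ℕ} (hn : Odd n) : ∀ f ∈ A.dSpan, A.d n f ∈ A.dSpan := by
  refine iSup_ladder_le (S := A.dSpan.comap (A.d n)) ?_ fun i f hf hf' => ?_
  · rw [Submodule.span_singleton_le_iff_mem, Submodule.mem_comap,
      A.d_ω _ ((Int.odd_coe_nat n).mpr hn) (by have := hn.pos; omega)]
    exact Submodule.zero_mem _
  · rw [Submodule.mem_comap, A.d_create hn i (A.dSpan_le_vacuum hf)]
    refine Submodule.add_mem _ (apply_mem_iSup_ladder hf' i) ?_
    split_ifs
    · exact Submodule.smul_mem _ _ hf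
    · exact Submodule.zero_mem _

/-- Cyclicity replaces a basis theorem: the two-layer span contains `ω` and is stable under all
modes. -/
theorem ySpan_dSpan : A.ySpan A.dSpan = ⊤ := by
  refine A.cyclic _ (A.le_ySpan _ A.ω_mem_dSpan) (A.y_mem_ySpan A.dSpan_le_vacuum) fun n hn => ?_
  refine iSup_ladder_le (S := (A.ySpan A.dSpan).comap (A.d n)) (fun w hw => ?_)
    fun p f hf hf' => ?_
  · rw [Submodule.mem_comap]
    rcases le_or_gt n 0 with h | h
    · obtain ⟨i, hi⟩ := hn
      obtain ⟨j, rfl⟩ : ∃ j : ℕ, n = -(2 * j + 1 : ℕ) := ⟨(-i - 1).toNat, by omega⟩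
      refine (Submodule.smul_mem_iff_of_isUnit (r := (2 : R)) _
        (by simpa using A.isUnit_natCast 2 two_ne_zero)).mp ?_
      -- Recovers `2 d` as `create` plus `quad`; the factor `2` is then a unit.
      rw [← sub_add_cancel ((2 : R) • A.d (-(2 * j + 1 : ℕ)) w) (A.quad (2 * j) w)]
      exact Submodule.add_mem _ (A.le_ySpan _ (apply_mem_iSup_ladder (i := j) hw))
        (A.quad_mem_ySpan A.dSpan_le_vacuum _ (A.le_ySpan _ hw))
    · lift n to ℕ using h.le
      exact A.le_ySpan _ (A.d_mem_dSpan ((Int.odd_coe_nat n).mp hn) w hw)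
  · rw [Submodule.mem_comap, A.d_hat hn]
    exact Submodule.add_mem _ (A.hat_mem_ySpan p hf') (Submodule.sum_mem _ fun k _ =>
      Submodule.smul_mem _ _ (A.y_mem_ySpan A.dSpan_le_vacuum _ f hf))

theorem vacuum_eq_dSpan : A.vacuum = A.dSpan :=
  le_antisymm (fun _ hv => A.mem_of_mem_ySpan A.dSpan_le_vacuum (A.ySpan_dSpan ▸ Submodule.mem_top) hv)
    A.dSpan_le_vacuum

/-- The annihilation operators dual to `create`. -/
def annihilateD (i : ℕ) : Module.End R M :=
  Ring.inverse ((2 * i + 1 : ℕ) : R) • A.d (2 * i + 1 : ℕ)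

theorem annihilateD_create (i j N : ℕ) (f : M)
    (hf : f ∈ ladder A.create (Submodule.span R {A.ω}) N) :
    A.annihilateD i (A.create j f) = A.create j (A.annihilateD i f) + if i = j then f else 0 := by
  simp only [annihilateD, LinearMap.smul_apply]
  rw [A.d_create (odd_two_mul_add_one i) j (A.ladder_create_le_vacuum N hf), smul_add, map_smul]
  congr 1
  by_cases h : i = j
  · rw [if_pos h, if_pos (by omega), smul_smul,
      Ring.inverse_mul_cancel _ (A.isUnit_natCast (2 * i + 1) (Nat.succ_ne_zero _)), one_smul]
  · rw [if_neg h, if_neg (by omega), smul_zero]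

theorem annihilateD_eq_zero (i : ℕ) (w : M) (hw : w ∈ Submodule.span R {A.ω}) :
    A.annihilateD i w = 0 := by
  obtain ⟨r, rfl⟩ := Submodule.mem_span_singleton.mp hw
  rw [annihilateD, LinearMap.smul_apply, map_smul,
    A.d_ω _ ((Int.odd_coe_nat _).mpr (odd_two_mul_add_one i)) (by omega), smul_zero, smul_zero]

/-- A vector killed by all positive modes is an `R`-multiple of `ω`. -/
theorem mem_span_ω {v : M} (hy : v ∈ A.vacuum) (hd : ∀ n, Odd n → 1 ≤ n → A.d n v = 0) :
    v ∈ Submodule.span R {A.ω} := by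
  obtain ⟨N, hN⟩ := mem_iSup_ladder.mp (A.vacuum_eq_dSpan ▸ hy : v ∈ A.dSpan)
  refine mem_of_annihilated A.isUnit_natCast A.annihilateD_eq_zero A.annihilateD_create
    (fun i j N f hf => ?_) hN fun i => ?_
  · exact (Submodule.span_singleton_le_iff_mem _ _).mpr hf
      (A.create_create_sub_mem i j (A.ladder_create_le_vacuum N hf))
  · rw [annihilateD, LinearMap.smul_apply,
      hd _ ((Int.odd_coe_nat _).mpr (odd_two_mul_add_one i)) (by omega), smul_zero]

theorem y_locally_nilpotent {n : ℤ} (hn : 1 ≤ n) (v : M) : ∃ N, (A.y n ^ N) v = 0 := by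
  obtain ⟨i, rfl⟩ : ∃ i : ℕ, n = (i + 1 : ℕ) := ⟨(n - 1).toNat, by omega⟩
  obtain ⟨N, hN⟩ := mem_iSup_ladder.mp (A.ySpan_dSpan ▸ Submodule.mem_top : v ∈ A.ySpan A.dSpan)
  have h := annihilate_pow_eq_zero
    (fun i w hw => annihilate_eq_zero (A.dSpan_le_vacuum hw) i)
    (fun i j _ f _ => A.annihilate_hat i j f) i N v hN
  have e : A.y (i + 1 : ℕ) = sgn R (i + 1 : ℕ) • A.annihilate i := by
    rw [annihilate, smul_smul, sgn_mul_self, one_smul]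
  exact ⟨N + 1, by rw [e, smul_pow, LinearMap.smul_apply, h, smul_zero]⟩

/-- Restricted to the vacuum because the relation between the positive `d` and `create` is available
only there. -/
theorem d_locally_nilpotent {n : ℤ} (hn : Odd n) (h1 : 1 ≤ n) {v : M} (hv : v ∈ A.vacuum) :
    ∃ N, (A.d n ^ N) v = 0 := by
  obtain ⟨i, rfl⟩ : ∃ i : ℕ, n = (2 * i + 1 : ℕ) := by
    obtain ⟨k, hk⟩ := hn
    exact ⟨k.toNat, by omega⟩
  obtain ⟨N, hN⟩ := mem_iSup_ladder.mp (A.vacuum_eq_dSpan ▸ hv : v ∈ A.dSpan)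
  have h := annihilate_pow_eq_zero A.annihilateD_eq_zero A.annihilateD_create i N v hN
  have e : A.d (2 * i + 1 : ℕ) = ((2 * i + 1 : ℕ) : R) • A.annihilateD i := by
    rw [annihilateD, smul_smul, Ring.mul_inverse_cancel _ (A.isUnit_natCast (2 * i + 1) (Nat.succ_ne_zero _)),
      one_smul]
  exact ⟨N + 1, by rw [e, smul_pow, LinearMap.smul_apply, h, smul_zero]⟩

end TwistedAction
end NappiWitten
end

/-! ### Uniform generators of the twisted algebra and their brackets -/

noncomputable section
namespace NappiWitten
namespace Affine

theorem mode_add (x y : H4) (m : ℤ) : mode (x + y) m = mode x m + mode y m := by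
  simp only [mode, ← mk_add, TensorProduct.tmul_add, add_zero]

theorem mode_smul (r : ℂ) (x : H4) (m : ℤ) : mode (r • x) m = r • mode x m := by
  simp only [mode, ← mk_smul, TensorProduct.tmul_smul, mul_zero]

theorem span_modes :
    Submodule.span ℂ (insert central {u | ∃ x m, u = mode x m}) = ⊤ := by
  refine eq_top_iff.mpr fun u _ => ?_
  set S := Submodule.span ℂ (insert central {u | ∃ x m, u = mode x m}) with hS
  let e : Loop →ₗ[ℂ] Affine :=
    { toFun := fun f => mk f 0
      map_add' := fun f g => by rw [← mk_add, add_zero]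
      map_smul' := fun r f => by rw [RingHom.id_apply, ← mk_smul, mul_zero] }
  have h : S.mkQ ∘ₗ e = 0 := by
    ext m x
    change Submodule.Quotient.mk (mode x m) = _
    exact (Submodule.Quotient.mk_eq_zero S).mpr
      (Submodule.subset_span (Or.inr ⟨x, m, rfl⟩))
  have h2 : u = e u.loop + u.coeff • central := by
    change u = mk u.loop 0 + u.coeff • mk 0 1
    rw [← mk_smul, ← mk_add, smul_zero, add_zero, zero_add, mul_one, mk_loop_coeff]
  rw [h2]
  refine Submodule.add_mem _ ?_ (Submodule.smul_mem _ _ (Submodule.subset_span (Or.inl rfl)))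
  exact (Submodule.Quotient.mk_eq_zero S).mp (congrArg (fun l => l u.loop) h)

end Affine

open NappiWitten.Affine

namespace Twisted

/-- The mode `(a + b)(n)` for even `n` and `(a - b)(n)` for odd `n`. -/
def X (n : ℤ) : Twisted :=
  if h : Even n then aAddB n h else aSubB n (Int.not_even_iff_odd.mp h)

/-- The mode `c(n)` for odd `n`, and zero for even `n`. -/
def C (n : ℤ) : Twisted := if h : Odd n then c n h else 0

/-- The mode `d(n)` for odd `n`, and zero for even `n`. -/
def D (n : ℤ) : Twisted := if h : Odd n then d n h else 0

theorem X_of_even {n : ℤ} (h : Even n) : X n = aAddB n h := dif_pos h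
theorem X_of_odd {n : ℤ} (h : Odd n) : X n = aSubB n h := dif_neg (Int.not_even_iff_odd.mpr h)
theorem C_of_odd {n : ℤ} (h : Odd n) : C n = c n h := dif_pos h
theorem C_of_even {n : ℤ} (h : Even n) : C n = 0 := dif_neg (Int.not_odd_iff_even.mpr h)
theorem D_of_odd {n : ℤ} (h : Odd n) : D n = d n h := dif_pos h
theorem D_of_even {n : ℤ} (h : Even n) : D n = 0 := dif_neg (Int.not_odd_iff_even.mpr h)

theorem X_mem_pos {n : ℤ} (hn : 1 ≤ n) : X n ∈ pos := by
  rcases Int.even_or_odd n with h | h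
  · rw [X_of_even h]
    exact Submodule.subset_span (Or.inl ⟨n, h, by omega, rfl⟩)
  · rw [X_of_odd h]
    exact Submodule.subset_span (Or.inr ⟨n, h, by omega, Or.inl rfl⟩)

theorem C_mem_pos {n : ℤ} (hn : 1 ≤ n) : C n ∈ pos := by
  rcases Int.even_or_odd n with h | h
  · rw [C_of_even h]
    exact pos.zero_mem
  · rw [C_of_odd h]
    exact c_mem_pos n h (by omega)

theorem D_mem_pos {n : ℤ} (hn : 1 ≤ n) : D n ∈ pos := by
  rcases Int.even_or_odd n with h | h
  · rw [D_of_even h]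
    exact pos.zero_mem
  · rw [D_of_odd h]
    exact Submodule.subset_span (Or.inr ⟨n, h, by omega, Or.inr (Or.inr rfl)⟩)

theorem lie_eq_smul_add {u v w : Twisted} {x y z : H4} {m n : ℤ} (r : ℂ)
    (hu : (u : Affine) = mode x m) (hv : (v : Affine) = mode y n)
    (hw : (w : Affine) = mode z (m + n)) (h : ⁅x, y⁆ = r • z) :
    ∃ s : ℂ, ⁅u, v⁆ = r • w + s • k := by
  refine ⟨if m + n = 0 then (m : ℂ) * H4.form x y else 0, Subtype.ext ?_⟩
  change ⁅(u : Affine), (v : Affine)⁆ = r • (w : Affine) + _ • central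
  rw [hu, hv, hw, lie_mode_mode, h, mode_smul]

theorem lie_eq_smul_k {u v : Twisted} {x y : H4} {m n : ℤ}
    (hu : (u : Affine) = mode x m) (hv : (v : Affine) = mode y n) (h : ⁅x, y⁆ = 0) :
    ∃ s : ℂ, ⁅u, v⁆ = s • k := by
  refine ⟨if m + n = 0 then (m : ℂ) * H4.form x y else 0, Subtype.ext ?_⟩
  change ⁅(u : Affine), (v : Affine)⁆ = _ • central
  rw [hu, hv, lie_mode_mode, h, ← zero_smul ℂ (0 : H4), mode_smul, zero_smul, zero_add]

/-- Setting `C` to zero at even indices lets one formula cover all parities. The coefficient of `k`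
is left unspecified since `k` will act as zero. -/
theorem lie_X_X (m n : ℤ) :
    ∃ s : ℂ, ⁅X m, X n⁆ = (-2 * sgn ℂ m) • C (m + n) + s • k := by
  rcases Int.even_or_odd m with hm | hm <;> rcases Int.even_or_odd n with hn | hn
  · rw [X_of_even hm, X_of_even hn, C_of_even (hm.add hn), smul_zero]
    simpa only [zero_add] using lie_eq_smul_k rfl rfl (lie_self _)
  · rw [X_of_even hm, X_of_odd hn, C_of_odd (hm.add_odd hn), sgn_of_even hm]
    exact lie_eq_smul_add _ rfl rfl rfl (by ext <;> simp [H4.ea, H4.eb, H4.ec]; norm_num)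
  · rw [X_of_odd hm, X_of_even hn, C_of_odd (hm.add_even hn), sgn_of_odd hm]
    exact lie_eq_smul_add _ rfl rfl rfl (by ext <;> simp [H4.ea, H4.eb, H4.ec]; norm_num)
  · rw [X_of_odd hm, X_of_odd hn, C_of_even (hm.add_odd hn), smul_zero]
    simpa only [zero_add] using lie_eq_smul_k rfl rfl (lie_self _)

theorem lie_D_X {m : ℤ} (hm : Odd m) (n : ℤ) : ∃ s : ℂ, ⁅D m, X n⁆ = X (m + n) + s • k := by
  rw [D_of_odd hm]
  rcases Int.even_or_odd n with hn | hn
  · rw [X_of_even hn, X_of_odd (hm.add_even hn)]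
    simpa only [one_smul] using lie_eq_smul_add (w := aSubB (m + n) (hm.add_even hn)) 1 rfl rfl rfl
      (by ext <;> simp [H4.ea, H4.eb, H4.ed])
  · rw [X_of_odd hn, X_of_even (hm.add_odd hn)]
    simpa only [one_smul] using lie_eq_smul_add (w := aAddB (m + n) (hm.add_odd hn)) 1 rfl rfl rfl
      (by ext <;> simp [H4.ea, H4.eb, H4.ed])

theorem lie_D_D {m n : ℤ} (hm : Odd m) (hn : Odd n) : ∃ s : ℂ, ⁅D m, D n⁆ = s • k := by
  rw [D_of_odd hm, D_of_odd hn]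
  exact lie_eq_smul_k rfl rfl (lie_self _)

theorem lie_C_C (m n : ℤ) : ⁅C m, C n⁆ = 0 := by
  rcases Int.even_or_odd m with hm | hm
  · rw [C_of_even hm, zero_lie]
  rcases Int.even_or_odd n with hn | hn
  · rw [C_of_even hn, lie_zero]
  rw [C_of_odd hm, C_of_odd hn]
  apply Subtype.ext
  change ⁅mode H4.ec m, mode H4.ec n⁆ = 0
  have h : H4.form H4.ec H4.ec = 0 := by simp [H4.form_apply, H4.ec]
  rw [lie_mode_mode, h, mul_zero, ite_self, zero_smul, add_zero, lie_self,
    ← zero_smul ℂ (0 : H4), mode_smul, zero_smul]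

theorem span_X_C_D_k :
    Submodule.span ℂ (insert k (Set.range X ∪ Set.range C ∪ Set.range D)) = ⊤ := by
  set S := Submodule.span ℂ (insert k (Set.range X ∪ Set.range C ∪ Set.range D))
  have hX : ∀ n, X n ∈ S := fun n => Submodule.subset_span (Or.inr (Or.inl (Or.inl ⟨n, rfl⟩)))
  have hC : ∀ n, C n ∈ S := fun n => Submodule.subset_span (Or.inr (Or.inl (Or.inr ⟨n, rfl⟩)))
  have hD : ∀ n, D n ∈ S := fun n => Submodule.subset_span (Or.inr (Or.inr ⟨n, rfl⟩))
  let i : Twisted →ₗ[ℂ] Affine := twistedSubalgebra.toSubmodule.subtype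
  -- Averaging over the involution: `T` sends the spanning modes of the affine algebra into the
  -- claimed span and is multiplication by `2` on fixed points.
  let T : Affine →ₗ[ℂ] Affine := LinearMap.id + (tauHat : Affine →ₗ[ℂ] Affine)
  have key : (⊤ : Submodule ℂ Affine) ≤ (S.map i).comap T := by
    rw [← span_modes, Submodule.span_le]
    rintro u (rfl | ⟨x, m, rfl⟩)
    · refine ⟨(2 : ℂ) • k, S.smul_mem _ (Submodule.subset_span (Or.inl rfl)), ?_⟩
      change (2 : ℂ) • central = central + tauHat central
      rw [tauHat_central, two_smul]
    · change mode x m + tauHat (mode x m) ∈ S.map i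
      rw [tauHat_mode, ← mode_smul, ← mode_add]
      rcases Int.even_or_odd m with hm | hm
      · refine ⟨(x.a + x.b) • X m, S.smul_mem _ (hX m), ?_⟩
        rw [X_of_even hm]
        change (x.a + x.b) • mode (H4.ea + H4.eb) m = _
        rw [← mode_smul, hm.neg_one_zpow]
        congr 1
        ext <;> simp [H4.ea, H4.eb, H4.tau_apply, add_comm]
      · refine ⟨(x.a - x.b) • X m + (2 * x.c) • C m + (2 * x.d) • D m, S.add_mem (S.add_mem
          (S.smul_mem _ (hX m)) (S.smul_mem _ (hC m))) (S.smul_mem _ (hD m)), ?_⟩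
        rw [X_of_odd hm, C_of_odd hm, D_of_odd hm]
        change (x.a - x.b) • mode (H4.ea - H4.eb) m + (2 * x.c) • mode H4.ec m +
          (2 * x.d) • mode H4.ed m = _
        rw [← mode_smul, ← mode_smul, ← mode_smul, ← mode_add, ← mode_add, hm.neg_one_zpow]
        congr 1
        ext <;> simp [H4.ea, H4.eb, H4.ec, H4.ed, H4.tau_apply] <;> ring
  refine eq_top_iff.mpr fun u _ => ?_
  obtain ⟨w, hw, hwu⟩ := key (Submodule.mem_top (x := (u : Affine)))
  have h : w = (2 : ℂ) • u := by
    apply Subtype.ext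
    change i w = (2 : ℂ) • (u : Affine)
    rw [hwu, two_smul]
    change (u : Affine) + tauHat u = _
    rw [mem_twistedSubalgebra.mp u.2]
  rw [h] at hw
  exact (Submodule.smul_mem_iff S two_ne_zero).mp hw

theorem lie_C (n : ℤ) (u : Twisted) : ∃ s : ℂ, ⁅C n, u⁆ = s • k := by
  rcases Int.even_or_odd n with hn | hn
  · exact ⟨0, by rw [C_of_even hn, zero_lie, zero_smul]⟩
  rw [C_of_odd hn]
  have h : u ∈ Submodule.span ℂ (insert k (Set.range X ∪ Set.range C ∪ Set.range D)) :=
    span_X_C_D_k ▸ Submodule.mem_top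
  induction h using Submodule.span_induction with
  | mem x hx =>
    rcases hx with rfl | (⟨m, rfl⟩ | ⟨m, rfl⟩) | ⟨m, rfl⟩
    · refine ⟨0, Subtype.ext ?_⟩
      rw [zero_smul]
      exact lie_central _
    · rcases Int.even_or_odd m with hm | hm
      · rw [X_of_even hm]; exact lie_eq_smul_k rfl rfl (H4.lie_ec _)
      · rw [X_of_odd hm]; exact lie_eq_smul_k rfl rfl (H4.lie_ec _)
    · exact ⟨0, by rw [← C_of_odd hn, lie_C_C, zero_smul]⟩
    · rcases Int.even_or_odd m with hm | hm
      · exact ⟨0, by rw [D_of_even hm, lie_zero, zero_smul]⟩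
      · rw [D_of_odd hm]; exact lie_eq_smul_k rfl rfl (H4.lie_ec _)
  | zero => exact ⟨0, by rw [lie_zero, zero_smul]⟩
  | add x y _ _ hx hy =>
    obtain ⟨s, hs⟩ := hx
    obtain ⟨t, ht⟩ := hy
    exact ⟨s + t, by rw [lie_add, hs, ht, add_smul]⟩
  | smul r x _ hx =>
    obtain ⟨s, hs⟩ := hx
    exact ⟨r * s, by rw [lie_smul, hs, mul_smul]⟩

end Twisted
end NappiWitten
end

/-! ### Level zero representations and reduction to the abstract action -/

noncomputable section
namespace NappiWitten
open NappiWitten.Twisted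
open scoped IsMulCommutative

/-- A representation of `Ĥ₄[τ]` of level zero. -/
structure LevelZeroRep (V : Type*) [AddCommGroup V] [Module ℂ V] where
  act : Twisted →ₗ[ℂ] Module.End ℂ V
  act_lie : ∀ x y v, act ⁅x, y⁆ v = act x (act y v) - act y (act x v)
  act_k : act k = 0

namespace LevelZeroRep

variable {V : Type*} [AddCommGroup V] [Module ℂ V] (ρ : LevelZeroRep V)

theorem act_act_of_lie {x y z : Twisted} {r : ℂ} (h : ∃ s : ℂ, ⁅x, y⁆ = r • z + s • k)
    (v : V) : ρ.act x (ρ.act y v) = ρ.act y (ρ.act x v) + r • ρ.act z v := by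
  obtain ⟨s, hs⟩ := h
  have e := ρ.act_lie x y v
  rw [hs, map_add, map_smul, map_smul, ρ.act_k, smul_zero, add_zero, LinearMap.smul_apply] at e
  rw [e, add_sub_cancel]

theorem act_X_X (m n : ℤ) (v : V) : ρ.act (X m) (ρ.act (X n) v) =
    ρ.act (X n) (ρ.act (X m) v) + (-2 * sgn ℂ m) • ρ.act (C (m + n)) v :=
  ρ.act_act_of_lie (lie_X_X m n) v

theorem act_D_X {m : ℤ} (hm : Odd m) (n : ℤ) (v : V) :
    ρ.act (D m) (ρ.act (X n) v) = ρ.act (X n) (ρ.act (D m) v) + ρ.act (X (m + n)) v := by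
  rw [ρ.act_act_of_lie (r := 1) (z := X (m + n)) (by simpa only [one_smul] using lie_D_X hm n),
    one_smul]

theorem act_D_D {m n : ℤ} (hm : Odd m) (hn : Odd n) (v : V) :
    ρ.act (D m) (ρ.act (D n) v) = ρ.act (D n) (ρ.act (D m) v) := by
  rw [ρ.act_act_of_lie (r := 0) (z := 0) (by simpa only [smul_zero, zero_add] using lie_D_D hm hn),
    zero_smul, add_zero]

theorem act_C_comm (n : ℤ) (x : Twisted) (v : V) :
    ρ.act (C n) (ρ.act x v) = ρ.act x (ρ.act (C n) v) := by
  rw [ρ.act_act_of_lie (r := 0) (z := 0) (by simpa only [smul_zero, zero_add] using lie_C n x),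
    zero_smul, add_zero]

/-- The commutative algebra of operators generated by the modes of `c`. -/
abbrev cAlgebra : Subalgebra ℂ (Module.End ℂ V) :=
  Algebra.adjoin ℂ (Set.range fun n => ρ.act (C n))

instance : IsMulCommutative ρ.cAlgebra :=
  Algebra.isMulCommutative_adjoin ℂ (by
    rintro _ ⟨m, rfl⟩ _ ⟨n, rfl⟩
    exact LinearMap.ext (ρ.act_C_comm m (C n)))

theorem cAlgebra_comm {r : Module.End ℂ V} (hr : r ∈ ρ.cAlgebra) (x : Twisted)
    (v : V) : ρ.act x (r v) = r (ρ.act x v) := by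
  induction hr using Algebra.adjoin_induction generalizing v with
  | mem _ h =>
    obtain ⟨n, rfl⟩ := h
    exact (ρ.act_C_comm n x v).symm
  | algebraMap r => exact map_smul (ρ.act x) r v
  | add r s _ _ hr hs => rw [LinearMap.add_apply, LinearMap.add_apply, map_add, hr, hs]
  | mul r s _ _ hr hs => rw [Module.End.mul_apply, Module.End.mul_apply, hr, hs]

/-- The action of `Ĥ₄[τ]` by linear maps over the algebra of the modes of `c`. -/
def actLin (x : Twisted) : Module.End ρ.cAlgebra V where
  toFun := ρ.act x
  map_add' := map_add (ρ.act x)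
  map_smul' r v := ρ.cAlgebra_comm r.2 x v

theorem actLin_apply (x : Twisted) (v : V) : ρ.actLin x v = ρ.act x v := rfl

/-- The operator `x - r` for a scalar `r`, as a linear map over the algebra of the modes of `c`. -/
def actSubLin (x : Twisted) (r : ℂ) : Module.End ρ.cAlgebra V where
  toFun v := ρ.act x v - r • v
  map_add' v w := by rw [map_add, smul_add, add_sub_add_comm]
  map_smul' s v := by
    change ρ.act x (s.1 v) - r • s.1 v = s.1 (ρ.act x v - r • v)
    rw [ρ.cAlgebra_comm s.2, map_sub, map_smul]

theorem actSubLin_apply (x : Twisted) (r : ℂ) (v : V) :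
    ρ.actSubLin x r v = ρ.act x v - r • v := rfl

/-- The mode `c(n)` as an element of `cAlgebra`. -/
def cMode (n : ℤ) : ρ.cAlgebra := ⟨ρ.act (C n), Algebra.subset_adjoin ⟨n, rfl⟩⟩

theorem cMode_smul (n : ℤ) (v : V) : ρ.cMode n • v = ρ.act (C n) v := rfl

theorem algebraMap_cAlgebra_smul (r : ℂ) (v : V) :
    (algebraMap ℂ ρ.cAlgebra r) • v = r • v := rfl

theorem sgn_cAlgebra_smul (m : ℤ) (v : V) :
    sgn ρ.cAlgebra m • v = sgn ℂ m • v := by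
  rcases Int.even_or_odd m with h | h
  · rw [sgn_of_even h, sgn_of_even h, one_smul, one_smul]
  · rw [sgn_of_odd h, sgn_of_odd h, neg_smul, neg_smul, one_smul, one_smul]

/-- The positive part `Ĥ₄[τ]⁽⁺⁾` acts on `v` through the character `χ`; `v` may be zero. -/
def IsPosEigenvector (χ : LieAlgebra.LieCharacter ℂ pos) (v : V) : Prop :=
  ∀ x : pos, ρ.act (x : Twisted) v = χ x • v

/-- The vector `ω` generates the representation. -/
def IsCyclic (ω : V) : Prop :=
  ∀ S : Submodule ℂ V, ω ∈ S → (∀ x, ∀ v ∈ S, ρ.act x v ∈ S) → S = ⊤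

variable {ρ} {ψ χ : LieAlgebra.LieCharacter ℂ pos} {ω : V}

namespace IsPosEigenvector

/-- Up to a multiple of `k`, `X n` is the bracket of `D 1` and `X (n - 1)`, both positive; operators
acting on `ω` by scalars have commutator zero there. -/
theorem act_X_of_two_le (hω : ρ.IsPosEigenvector ψ ω) {n : ℤ} (hn : 2 ≤ n) :
    ρ.act (X n) ω = 0 := by
  have h := ρ.act_D_X odd_one (n - 1) ω
  have h1 := hω ⟨X (n - 1), X_mem_pos (by omega)⟩
  have h2 := hω ⟨D 1, D_mem_pos le_rfl⟩
  simp only at h1 h2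
  rw [h1, h2, map_smul, map_smul, h1, h2, smul_comm, left_eq_add] at h
  rwa [show (1 : ℤ) + (n - 1) = n by ring] at h

theorem act_C_of_two_le (hω : ρ.IsPosEigenvector ψ ω) {n : ℤ} (hn : 2 ≤ n) :
    ρ.act (C n) ω = 0 := by
  have h := ρ.act_X_X 1 (n - 1) ω
  have h1 := hω ⟨X (n - 1), X_mem_pos (by omega)⟩
  have h2 := hω ⟨X 1, X_mem_pos le_rfl⟩
  simp only at h1 h2
  rw [h1, h2, map_smul, map_smul, h1, h2, smul_comm, left_eq_add] at h
  rw [show (1 : ℤ) + (n - 1) = n by ring, sgn_of_odd odd_one] at h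
  simpa using h

end IsPosEigenvector

/-- The locus where the central operator agrees with the scalar is a subrepresentation containing
the generator. -/
theorem IsCyclic.act_C_eq_smul (hc : ρ.IsCyclic ω) {n : ℤ} {r : ℂ} (h : ρ.act (C n) ω = r • ω)
    (v : V) : ρ.act (C n) v = r • v := by
  have e : LinearMap.eqLocus (ρ.act (C n)) (r • LinearMap.id) = ⊤ := by
    refine hc _ h fun x v hv => ?_
    rw [LinearMap.mem_eqLocus, LinearMap.smul_apply, LinearMap.id_apply] at hv ⊢
    rw [act_C_comm, hv, map_smul]
  exact (e ▸ Submodule.mem_top : v ∈ LinearMap.eqLocus _ _)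

theorem act_C_eq_zero (hc : ρ.IsCyclic ω) (hω : ρ.IsPosEigenvector ψ ω) {n : ℤ} (hn : 2 ≤ n)
    (v : V) : ρ.act (C n) v = 0 := by
  rw [hc.act_C_eq_smul (r := 0) (by rw [hω.act_C_of_two_le hn, zero_smul]), zero_smul]

theorem act_C_one (hc : ρ.IsCyclic ω) (hω : ρ.IsPosEigenvector ψ ω) (v : V) :
    ρ.act (C 1) v = ψ ⟨C 1, C_mem_pos le_rfl⟩ • v :=
  hc.act_C_eq_smul (hω ⟨C 1, C_mem_pos le_rfl⟩) v

/-- The elements `X n - s c(n)`; for a suitable `s` all of them with `n ≥ 1` kill `ω`. -/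
def shiftedX (s : ℂ) (n : ℤ) : Twisted := X n - s • C n

/-- The elements `d(n)`, corrected so that their bracket with the `shiftedX` is again one. -/
def shiftedD (s : ℂ) (n : ℤ) : Twisted := D n - (s / 2) • shiftedX s n

theorem act_shiftedX (s : ℂ) (n : ℤ) (v : V) :
    ρ.act (shiftedX s n) v = ρ.act (X n) v - s • ρ.act (C n) v := by
  rw [shiftedX, map_sub, map_smul, LinearMap.sub_apply, LinearMap.smul_apply]

theorem act_shiftedD (s : ℂ) (n : ℤ) (v : V) :
    ρ.act (shiftedD s n) v = ρ.act (D n) v - (s / 2) • ρ.act (shiftedX s n) v := by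
  rw [shiftedD, map_sub, map_smul, LinearMap.sub_apply, LinearMap.smul_apply]

theorem act_shiftedX_shiftedX (s : ℂ) (m n : ℤ) (v : V) :
    ρ.act (shiftedX s m) (ρ.act (shiftedX s n) v) =
      ρ.act (shiftedX s n) (ρ.act (shiftedX s m) v) + (-2 * sgn ℂ m) • ρ.act (C (m + n)) v := by
  simp only [act_shiftedX, map_sub, map_smul, ρ.act_X_X m n, ρ.act_C_comm _ (X _)]
  rw [ρ.act_C_comm m (C n)]
  module

theorem act_D_shiftedX (s : ℂ) {m : ℤ} (hm : Odd m) (n : ℤ) (v : V) :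
    ρ.act (D m) (ρ.act (shiftedX s n) v) = ρ.act (shiftedX s n) (ρ.act (D m) v) +
      ρ.act (shiftedX s (m + n)) v + s • ρ.act (C (m + n)) v := by
  simp only [act_shiftedX, map_sub, map_smul, ρ.act_D_X hm n, ρ.act_C_comm _ (D _)]
  module

/-- `D m` alone leaves an error `s C (m + n)`; for `m` odd the bracket of `-(s/2) shiftedX s m`
contributes exactly `-s C (m + n)`. -/
theorem act_shiftedD_shiftedX (s : ℂ) {m : ℤ} (hm : Odd m) (n : ℤ) (v : V) :
    ρ.act (shiftedD s m) (ρ.act (shiftedX s n) v) =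
      ρ.act (shiftedX s n) (ρ.act (shiftedD s m) v) + ρ.act (shiftedX s (m + n)) v := by
  simp only [act_shiftedD, map_sub, map_smul, act_D_shiftedX s hm n,
    act_shiftedX_shiftedX s m n, sgn_of_odd hm]
  module

theorem act_shiftedD_shiftedD (s : ℂ) {m n : ℤ} (hm : Odd m) (hn : Odd n) (v : V) :
    ρ.act (shiftedD s m) (ρ.act (shiftedD s n) v) =
      ρ.act (shiftedD s n) (ρ.act (shiftedD s m) v) := by
  have h : ρ.act (C (m + n)) v = 0 := by
    rw [C_of_even (hm.add_odd hn), map_zero, LinearMap.zero_apply]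
  simp only [act_shiftedD, map_sub, map_smul, act_D_shiftedX s hm n, act_D_shiftedX s hn m,
    act_shiftedX_shiftedX s m n, ρ.act_D_D hm hn, add_comm n m, h]
  module

/-- The scalar by which `shiftedX s n`, `n ≥ 1`, acts on a vector of type `χ`. -/
theorem IsPosEigenvector.exists_shiftedX (h : ρ.IsPosEigenvector χ ω) (s : ℂ) {n : ℤ} (hn : 1 ≤ n) :
    ∃ r : ℂ, ρ.act (shiftedX s n) ω = r • ω :=
  ⟨χ ⟨X n, X_mem_pos hn⟩ - s * χ ⟨C n, C_mem_pos hn⟩, by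
    have h1 := h ⟨X n, X_mem_pos hn⟩
    have h2 := h ⟨C n, C_mem_pos hn⟩
    simp only at h1 h2
    rw [act_shiftedX, h1, h2]
    module⟩

theorem IsPosEigenvector.exists_shiftedD (h : ρ.IsPosEigenvector χ ω) (s : ℂ) {n : ℤ} (hn : 1 ≤ n) :
    ∃ r : ℂ, ρ.act (shiftedD s n) ω = r • ω := by
  obtain ⟨r, hr⟩ := h.exists_shiftedX s hn
  have h1 := h ⟨D n, D_mem_pos hn⟩
  simp only at h1
  exact ⟨χ ⟨D n, D_mem_pos hn⟩ - s / 2 * r, by rw [act_shiftedD, h1, hr]; module⟩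

/-- The ratio `ψ((a - b)(1)) / ψ(c(1))`. -/
def shift (ψ : LieAlgebra.LieCharacter ℂ pos) : ℂ :=
  ψ ⟨X 1, X_mem_pos le_rfl⟩ / ψ ⟨C 1, C_mem_pos le_rfl⟩

theorem IsPosEigenvector.shiftedX_eq_zero (hω : ρ.IsPosEigenvector ψ ω)
    (hψ : ψ ⟨C 1, C_mem_pos le_rfl⟩ ≠ 0) {n : ℤ} (hn : 1 ≤ n) :
    ρ.act (shiftedX (shift ψ) n) ω = 0 := by
  rw [act_shiftedX]
  rcases hn.eq_or_lt with rfl | h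
  · have h1 := hω ⟨X 1, X_mem_pos le_rfl⟩
    have h2 := hω ⟨C 1, C_mem_pos le_rfl⟩
    simp only at h1 h2
    rw [h1, h2, smul_smul, shift, div_mul_cancel₀ _ hψ, sub_self]
  · rw [hω.act_X_of_two_le h, hω.act_C_of_two_le h, smul_zero, sub_zero]

/-- The scalar by which `shiftedD`, `n ≥ 1`, acts on `ω`; zero for `n ≤ 0`. -/
def eigenvalueD (hω : ρ.IsPosEigenvector ψ ω) (n : ℤ) : ℂ :=
  if h : 1 ≤ n then (hω.exists_shiftedD (shift ψ) h).choose else 0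

theorem act_shiftedD_eigenvalueD (hω : ρ.IsPosEigenvector ψ ω) {n : ℤ} (hn : 1 ≤ n) :
    ρ.act (shiftedD (shift ψ) n) ω = eigenvalueD hω n • ω := by
  rw [eigenvalueD, dif_pos hn]
  exact (hω.exists_shiftedD (shift ψ) hn).choose_spec

/-- The operators on a level zero representation generated by a vector of type `ψ`. -/
def twistedAction (hc : ρ.IsCyclic ω) (hω : ρ.IsPosEigenvector ψ ω)
    (hψ : ψ ⟨C 1, C_mem_pos le_rfl⟩ ≠ 0) : TwistedAction ρ.cAlgebra V where
  c n := algebraMap ℂ ρ.cAlgebra (-2) * ρ.cMode n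
  y n := ρ.actLin (shiftedX (shift ψ) n)
  d n := ρ.actSubLin (shiftedD (shift ψ) n) (eigenvalueD hω n)
  ω := ω
  isUnit_natCast n hn := by
    have h : IsUnit (n : ℂ) := isUnit_iff_ne_zero.mpr (Nat.cast_ne_zero.mpr hn)
    have h2 := h.map (algebraMap ℂ ρ.cAlgebra)
    rwa [map_natCast] at h2
  isUnit_c_one := by
    have h : ρ.cMode 1 = algebraMap ℂ ρ.cAlgebra (ψ ⟨C 1, C_mem_pos le_rfl⟩) :=
      Subtype.ext (LinearMap.ext fun v => act_C_one hc hω v)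
    rw [h, ← map_mul]
    exact (isUnit_iff_ne_zero.mpr (mul_ne_zero (by norm_num) hψ)).map (algebraMap ℂ ρ.cAlgebra)
  c_of_one_lt n hn := by
    have h : ρ.cMode n = 0 := Subtype.ext (LinearMap.ext fun v => act_C_eq_zero hc hω hn v)
    rw [h, mul_zero]
  c_of_even n hn := by
    have h : ρ.cMode n = 0 := Subtype.ext (by
      change ρ.act (C n) = 0
      rw [C_of_even hn, map_zero])
    rw [h, mul_zero]
  y_y m n v := by
    rw [mul_smul, mul_smul, sgn_cAlgebra_smul, algebraMap_cAlgebra_smul, cMode_smul, smul_smul,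
      mul_comm (sgn ℂ m)]
    exact act_shiftedX_shiftedX _ m n v
  d_y m n v hm := by
    simp only [actLin_apply, actSubLin_apply, map_sub, map_smul, act_shiftedD_shiftedX _ hm]
    abel
  d_d m n v hm hn := by
    simp only [actSubLin_apply, map_sub, map_smul, act_shiftedD_shiftedD _ hm hn]
    rw [smul_comm (eigenvalueD hω m)]
    abel
  y_ω n hn := hω.shiftedX_eq_zero hψ hn
  d_ω n _ hn := by
    rw [actSubLin_apply, act_shiftedD_eigenvalueD hω hn, sub_self]
  cyclic S hωS hy hd := by
    have hC : ∀ n, ∀ v ∈ S, ρ.act (C n) v ∈ S := fun n v hv => S.smul_mem (ρ.cMode n) hv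
    have hr : ∀ r : ℂ, ∀ v ∈ S, r • v ∈ S := fun r v hv =>
      S.smul_mem (algebraMap ℂ ρ.cAlgebra r) hv
    -- The changes of generators are undone: `S` is an `R`-submodule, hence stable under the modes
    -- of `c` and complex scalars, so it is stable under the original `X` and `D`.
    have hX : ∀ n, ∀ v ∈ S, ρ.act (X n) v ∈ S := fun n v hv => by
      have h := S.add_mem (hy n v hv) (hr (shift ψ) _ (hC n v hv))
      rwa [actLin_apply, act_shiftedX, sub_add_cancel] at h
    have hD : ∀ n, ∀ v ∈ S, ρ.act (D n) v ∈ S := fun n v hv => by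
      rcases Int.even_or_odd n with hn | hn
      · rw [D_of_even hn, map_zero]; exact S.zero_mem
      have h := S.add_mem (S.add_mem (hd n hn v hv) (hr (eigenvalueD hω n) v hv))
        (hr (shift ψ / 2) _ (hy n v hv))
      rwa [actSubLin_apply, sub_add_cancel, actLin_apply, act_shiftedD, sub_add_cancel] at h
    let S' : Submodule ℂ V := { S.toAddSubmonoid with smul_mem' := fun r v hv => hr r v hv }
    have h : S' = ⊤ := by
      refine hc S' hωS fun x v hv => ?_
      have hx : x ∈ Submodule.span ℂ (insert k (Set.range X ∪ Set.range C ∪ Set.range D)) :=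
        span_X_C_D_k ▸ Submodule.mem_top
      induction hx using Submodule.span_induction with
      | mem x hx =>
        rcases hx with rfl | (⟨m, rfl⟩ | ⟨m, rfl⟩) | ⟨m, rfl⟩
        · rw [ρ.act_k]; exact S'.zero_mem
        · exact hX m v hv
        · exact hC m v hv
        · exact hD m v hv
      | zero => rw [map_zero]; exact S'.zero_mem
      | add x y _ _ hx hy => rw [map_add]; exact S'.add_mem hx hy
      | smul r x _ hx => rw [map_smul]; exact S'.smul_mem r hx
    exact eq_top_iff.mpr fun v _ => (h ▸ Submodule.mem_top : v ∈ S')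

theorem eq_zero_of_pow_apply {K W : Type*} [Semiring K] [AddCommGroup W] [Module K W] [Module ℂ W]
    {T : Module.End K W} (hT : ∀ (r : ℂ) (v : W), T (r • v) = r • T v) {r : ℂ} {v : W} (hv : v ≠ 0)
    (h : T v = r • v) {N : ℕ} (hN : (T ^ N) v = 0) : r = 0 := by
  have e : ∀ N : ℕ, (T ^ N) v = r ^ N • v := by
    intro N
    induction N with
    | zero => simp
    | succ N ih => rw [pow_succ', Module.End.mul_apply, ih, hT, h, smul_smul, pow_succ]
  rw [e, smul_eq_zero_iff_left hv] at hN
  exact eq_zero_of_pow_eq_zero hN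

/-- A vector of some type `χ` is obtained from `ω` by the algebra of the modes of `c`. -/
theorem exists_cAlgebra_eq (hc : ρ.IsCyclic ω) (hω : ρ.IsPosEigenvector ψ ω)
    (hψ : ψ ⟨C 1, C_mem_pos le_rfl⟩ ≠ 0) {v : V} (hv : v ≠ 0) (h : ρ.IsPosEigenvector χ v) :
    ∃ r ∈ ρ.cAlgebra, v = r ω := by
  let A := twistedAction hc hω hψ
  have hy : v ∈ A.vacuum := by
    refine TwistedAction.mem_vacuum.mpr fun n hn => ?_
    obtain ⟨r, hr⟩ := h.exists_shiftedX (shift ψ) hn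
    obtain ⟨N, hN⟩ := A.y_locally_nilpotent hn v
    have : r = 0 := eq_zero_of_pow_apply (T := A.y n)
      (fun r v => map_smul (ρ.act (shiftedX (shift ψ) n)) r v) hv hr hN
    rw [this, zero_smul] at hr
    exact hr
  -- This has to follow `hy`, since local nilpotency of the `d` needs `v` in the vacuum.
  have hd : ∀ n, Odd n → 1 ≤ n → A.d n v = 0 := by
    intro n hn h1
    obtain ⟨r, hr⟩ := h.exists_shiftedD (shift ψ) h1
    have hr' : A.d n v = (r - eigenvalueD hω n) • v := by
      rw [sub_smul, ← hr]
      rfl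
    obtain ⟨N, hN⟩ := A.d_locally_nilpotent hn h1 hy
    have : r - eigenvalueD hω n = 0 := eq_zero_of_pow_apply (T := A.d n)
      (fun r v => (A.d n).map_smul (algebraMap ℂ ρ.cAlgebra r) v) hv hr' hN
    rw [hr', this, zero_smul]
  obtain ⟨r, hr⟩ := Submodule.mem_span_singleton.mp (A.mem_span_ω hy hd)
  exact ⟨r, r.2, hr.symm⟩

theorem IsPosEigenvector.cAlgebra_apply (hω : ρ.IsPosEigenvector ψ ω) {r : Module.End ℂ V}
    (hr : r ∈ ρ.cAlgebra) : ρ.IsPosEigenvector ψ (r ω) := fun x => by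
  rw [ρ.cAlgebra_comm hr, hω x, map_smul]

/-- A subspace that contains `ω` and is stable under the `c(-i)` contains `cAlgebra ω`. -/
theorem cAlgebra_apply_mem (hc : ρ.IsCyclic ω) (hω : ρ.IsPosEigenvector ψ ω) {S : Submodule ℂ V}
    (hS : ω ∈ S) (h : ∀ i : ℕ, Odd i → ∀ v ∈ S, ρ.act (C (-i)) v ∈ S) {r : Module.End ℂ V}
    (hr : r ∈ ρ.cAlgebra) : r ω ∈ S := by
  have key : ∀ n, ∀ v ∈ S, ρ.act (C n) v ∈ S := by
    intro n v hv
    rcases Int.even_or_odd n with hn | hn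
    · rw [C_of_even hn, map_zero]; exact S.zero_mem
    rcases lt_trichotomy n 1 with h1 | rfl | h1
    · have hn0 : n ≠ 0 := by rintro rfl; exact absurd hn (by decide)
      obtain ⟨i, rfl⟩ := Int.exists_eq_neg_ofNat (show n ≤ 0 by omega)
      exact h i ((Int.odd_coe_nat i).mp (by simpa using hn.neg)) v hv
    · rw [act_C_one hc hω]; exact S.smul_mem _ hv
    · rw [act_C_eq_zero hc hω h1]; exact S.zero_mem
  have : ∀ v ∈ S, r v ∈ S := by
    induction hr using Algebra.adjoin_induction with
    | mem _ hx => obtain ⟨n, rfl⟩ := hx; exact key n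
    | algebraMap r => exact fun v hv => S.smul_mem r hv
    | add r s _ _ hr hs => exact fun v hv => S.add_mem (hr v hv) (hs v hv)
    | mul r s _ _ hr hs => exact fun v hv => hr _ (hs v hv)
  exact this ω hS

end LevelZeroRep
end NappiWitten
end

/-! ### The enveloping algebra, `L_{ψ,0}`, and the span of the `c(-η) ω̄` -/

noncomputable section
namespace NappiWitten
open NappiWitten.Twisted

section

attribute [local instance 100] LieRing.ofAssociativeRing

theorem toU_lie (x y : Twisted) : toU ⁅x, y⁆ = toU x * toU y - toU y * toU x :=
  (LieHom.map_lie (UniversalEnvelopingAlgebra.ι ℂ) x y).trans (LieRing.of_associative_ring_bracket _ _)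

theorem toU_add (x y : Twisted) : toU (x + y) = toU x + toU y :=
  map_add (UniversalEnvelopingAlgebra.ι ℂ) x y

theorem toU_smul (r : ℂ) (x : Twisted) : toU (r • x) = r • toU x :=
  map_smul (UniversalEnvelopingAlgebra.ι ℂ) r x

theorem toU_zero : toU 0 = 0 := map_zero (UniversalEnvelopingAlgebra.ι ℂ)

theorem UPos.incl_ι (x : pos) : UPos.incl (UniversalEnvelopingAlgebra.ι ℂ x) = toU (x : Twisted) :=
  UniversalEnvelopingAlgebra.lift_ι_apply ℂ _ x

theorem UPos.char_ι (ψ : LieAlgebra.LieCharacter ℂ pos) (x : pos) :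
    UPos.char ψ (UniversalEnvelopingAlgebra.ι ℂ x) = ψ x :=
  UniversalEnvelopingAlgebra.lift_ι_apply ℂ ψ x

/-- The universal property gives a map into `S` whose composite with the inclusion is the identity,
as it is so on generators. -/
theorem subalgebra_eq_top {S : Subalgebra ℂ U} (h : ∀ x : Twisted, toU x ∈ S) : S = ⊤ := by
  let f : Twisted →ₗ⁅ℂ⁆ S :=
    { toFun := fun x => ⟨toU x, h x⟩
      map_add' := fun x y => Subtype.ext (map_add _ x y)
      map_smul' := fun r x => Subtype.ext (map_smul _ r x)
      map_lie' := fun {x y} => Subtype.ext (LieHom.map_lie _ x y) }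
  have e : S.val.comp (UniversalEnvelopingAlgebra.lift ℂ f) = AlgHom.id ℂ U := by
    apply UniversalEnvelopingAlgebra.hom_ext
    ext x
    simp [f]
  refine eq_top_iff.mpr fun u _ => ?_
  have h2 : ((UniversalEnvelopingAlgebra.lift ℂ f u : S) : U) = u := congrArg (fun g => g u) e
  rw [← h2]
  exact Subtype.prop _

end

variable {ψ : LieAlgebra.LieCharacter ℂ pos}

theorem pos_smul_omegaBar (x : pos) :
    toU (x : Twisted) • omegaBar ψ 0 = ψ x • omegaBar ψ 0 := by
  have h : toU (x : Twisted) • omega ψ = ψ x • omega ψ := by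
    refine (Submodule.Quotient.eq (inducedRelations ψ)).mpr (Submodule.subset_span
      ⟨1, UniversalEnvelopingAlgebra.ι ℂ x, 1, ?_⟩)
    beta_reduce
    rw [UPos.incl_ι, UPos.char_ι, one_mul, mul_one, TensorProduct.smul_tmul', smul_eq_mul, mul_one,
      ← TensorProduct.tmul_smul, smul_eq_mul, mul_one]
  exact congrArg (Submodule.Quotient.mk (p := kSubMul ψ 0)) h

theorem toU_k_smul (v : WhittakerL ψ 0) : toU k • v = 0 := by
  obtain ⟨m, rfl⟩ := Submodule.Quotient.mk_surjective _ v
  refine (Submodule.Quotient.mk_eq_zero _).mpr (Submodule.subset_span ⟨m, ?_⟩)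
  simp only [map_zero, sub_zero]

theorem eq_smul_omegaBar (v : WhittakerL ψ 0) : ∃ u : U, v = u • omegaBar ψ 0 := by
  obtain ⟨m, rfl⟩ := Submodule.Quotient.mk_surjective _ v
  obtain ⟨t, rfl⟩ := Submodule.Quotient.mk_surjective _ m
  suffices h : ∃ u : U, t = u • ((1 : U) ⊗ₜ[ℂ] (1 : ℂ)) by
    obtain ⟨u, rfl⟩ := h
    exact ⟨u, rfl⟩
  induction t using TensorProduct.induction_on with
  | zero => exact ⟨0, (zero_smul _ _).symm⟩
  | tmul u z =>
    refine ⟨z • u, ?_⟩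
    rw [TensorProduct.smul_tmul', smul_eq_mul, mul_one, TensorProduct.smul_tmul, smul_eq_mul, mul_one]
  | add s t hs ht =>
    obtain ⟨u, hu⟩ := hs
    obtain ⟨u', hu'⟩ := ht
    exact ⟨u + u', by rw [add_smul, ← hu, ← hu']⟩

theorem submodule_eq_top {S : Submodule ℂ (WhittakerL ψ 0)} (hω : omegaBar ψ 0 ∈ S)
    (h : ∀ x : Twisted, ∀ v ∈ S, toU x • v ∈ S) : S = ⊤ := by
  let B : Subalgebra ℂ U :=
    { carrier := {u | ∀ v ∈ S, u • v ∈ S}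
      mul_mem' := fun {a b} ha hb v hv => by rw [mul_smul]; exact ha _ (hb _ hv)
      add_mem' := fun {a b} ha hb v hv => by rw [add_smul]; exact S.add_mem (ha _ hv) (hb _ hv)
      algebraMap_mem' := fun r v hv => by rw [algebraMap_smul]; exact S.smul_mem r hv }
  have hB : B = ⊤ := subalgebra_eq_top fun x v hv => h x v hv
  refine eq_top_iff.mpr fun v _ => ?_
  obtain ⟨u, rfl⟩ := eq_smul_omegaBar v
  exact (hB ▸ Algebra.mem_top : u ∈ B) _ hω

/-- The action of `Ĥ₄[τ]` on a module over its enveloping algebra on which `k` acts as zero. -/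
def LevelZeroRep.ofModule (V : Type*) [AddCommGroup V] [Module U V] [Module ℂ V]
    [IsScalarTower ℂ U V] (h : ∀ v : V, toU k • v = 0) : LevelZeroRep V where
  act :=
    { toFun := fun x => Algebra.lsmul ℂ ℂ V (toU x)
      map_add' := fun x y => by rw [toU_add, map_add]
      map_smul' := fun r x => by rw [toU_smul, map_smul, RingHom.id_apply] }
  act_lie x y v := by
    change toU ⁅x, y⁆ • v = toU x • toU y • v - toU y • toU x • v
    rw [toU_lie, sub_smul, mul_smul, mul_smul]
  act_k := LinearMap.ext h

variable (ψ) in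
/-- The action of `Ĥ₄[τ]` on `L_{ψ,0}`. -/
def whittakerRep : LevelZeroRep (WhittakerL ψ 0) := LevelZeroRep.ofModule _ toU_k_smul

theorem whittakerRep_act (x : Twisted) (v : WhittakerL ψ 0) :
    (whittakerRep ψ).act x v = toU x • v := rfl

theorem isCyclic_omegaBar : (whittakerRep ψ).IsCyclic (omegaBar ψ 0) :=
  fun _ hω h => submodule_eq_top hω h

theorem isPosEigenvector_omegaBar : (whittakerRep ψ).IsPosEigenvector ψ (omegaBar ψ 0) :=
  pos_smul_omegaBar

theorem isWhittakerVector_iff {χ : LieAlgebra.LieCharacter ℂ pos} {v : WhittakerL ψ 0} :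
    IsWhittakerVector χ v ↔ v ≠ 0 ∧ (whittakerRep ψ).IsPosEigenvector χ v := by
  simp only [IsWhittakerVector, LevelZeroRep.IsPosEigenvector, whittakerRep_act, algebraMap_smul]

theorem cNeg_eq_prod (η : OddPartition) :
    cNeg η = (η.parts.map fun i : ℕ => toU (C (-(i : ℤ)))).prod := by
  rw [cNeg, ← List.pmap_eq_map η.odd]
  congr 1
  refine List.pmap_congr_left _ fun i _ hi _ => ?_
  rw [C_of_odd ((Int.odd_coe_nat i).mpr hi).neg]

/-- The empty partition. -/
def OddPartition.empty : OddPartition := ⟨[], List.Pairwise.nil, by simp⟩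

theorem cNeg_empty : cNeg OddPartition.empty = 1 := rfl

/-- Inserting `i` and sorting only permutes factors that commute. -/
theorem exists_toU_C_mul_cNeg (η : OddPartition) {i : ℕ} (hi : Odd i) :
    ∃ η' : OddPartition, toU (C (-(i : ℤ))) * cNeg η = cNeg η' := by
  have hp := List.perm_insertionSort (· ≤ ·) (i :: η.parts)
  refine ⟨⟨(i :: η.parts).insertionSort (· ≤ ·), List.pairwise_insertionSort _ _, fun j hj => ?_⟩, ?_⟩
  · rcases List.mem_cons.mp (hp.mem_iff.mp hj) with rfl | h
    · exact hi
    · exact η.odd j h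
  · rw [cNeg_eq_prod, cNeg_eq_prod, ← List.prod_cons,
      ← List.map_cons (f := fun i : ℕ => toU (C (-(i : ℤ))))]
    refine (hp.symm.map _).prod_eq' (List.pairwise_map.mpr (List.pairwise_of_forall fun j l => ?_))
    have h := toU_lie (C (-(j : ℤ))) (C (-(l : ℤ)))
    rw [lie_C_C, toU_zero] at h
    exact (sub_eq_zero.mp h.symm)

variable (ψ) in
/-- The linear combinations of `ω̄` and the vectors `c(-η) ω̄`. -/
abbrev cSpan : Submodule ℂ (WhittakerL ψ 0) :=
  Submodule.span ℂ
    (insert (omegaBar ψ 0) (Set.range fun η : OddPartition => cNeg η • omegaBar ψ 0))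

theorem toU_C_smul_mem_cSpan {i : ℕ} (hi : Odd i) :
    ∀ v ∈ cSpan ψ, toU (C (-(i : ℤ))) • v ∈ cSpan ψ := by
  suffices h : cSpan ψ ≤ (cSpan ψ).comap ((whittakerRep ψ).act (C (-(i : ℤ)))) from fun v hv => h hv
  have key : ∀ η : OddPartition, toU (C (-(i : ℤ))) • cNeg η • omegaBar ψ 0 ∈ cSpan ψ := by
    intro η
    obtain ⟨η', h⟩ := exists_toU_C_mul_cNeg η hi
    rw [← mul_smul, h]
    exact Submodule.subset_span (Or.inr ⟨η', rfl⟩)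
  rw [cSpan, Submodule.span_le]
  rintro v (rfl | ⟨η, rfl⟩)
  -- The generator `ω̄` is itself the vector attached to the empty partition.
  · have h := key OddPartition.empty
    rwa [cNeg_empty, one_smul] at h
  · exact key η

theorem cNeg_smul_isPosEigenvector (η : OddPartition) :
    (whittakerRep ψ).IsPosEigenvector ψ (cNeg η • omegaBar ψ 0) := by
  have h : ∀ l : List ℕ, ∃ r ∈ (whittakerRep ψ).cAlgebra,
      (l.map fun i : ℕ => toU (C (-(i : ℤ)))).prod • omegaBar ψ 0 = r (omegaBar ψ 0) := by
    intro l
    induction l with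
    | nil => exact ⟨1, Subalgebra.one_mem _, one_smul _ _⟩
    | cons i l ih =>
      obtain ⟨r, hr, e⟩ := ih
      refine ⟨(whittakerRep ψ).act (C (-(i : ℤ))) * r,
        Subalgebra.mul_mem _ (Algebra.subset_adjoin ⟨_, rfl⟩) hr, ?_⟩
      rw [List.map_cons, List.prod_cons, mul_smul, e]
      rfl
  obtain ⟨r, hr, e⟩ := h η.parts
  rw [cNeg_eq_prod, e]
  exact isPosEigenvector_omegaBar.cAlgebra_apply hr

theorem cSpan_isPosEigenvector : ∀ v ∈ cSpan ψ, (whittakerRep ψ).IsPosEigenvector ψ v := by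
  intro v hv
  induction hv using Submodule.span_induction with
  | mem v hv =>
    rcases hv with rfl | ⟨η, rfl⟩
    · exact isPosEigenvector_omegaBar
    · exact cNeg_smul_isPosEigenvector η
  | zero => exact fun x => by rw [map_zero, smul_zero]
  | add v w _ _ hv hw => exact fun x => by rw [map_add, hv x, hw x, smul_add]
  | smul r v _ hv => exact fun x => by rw [map_smul, hv x, smul_comm]

end NappiWitten
end
open NappiWitten

theorem theorem4p3 (ψ : LieAlgebra.LieCharacter ℂ Twisted.pos)
    (hψ : ψ ⟨Twisted.c 1 odd_one, Twisted.c_mem_pos 1 odd_one one_pos⟩ ≠ 0) :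
    (∀ (χ : LieAlgebra.LieCharacter ℂ Twisted.pos) (v : WhittakerL ψ 0), IsWhittakerVector χ v →
      v ≠ 0 ∧ v ∈ Submodule.span ℂ
        (insert (omegaBar ψ 0) (Set.range fun η : OddPartition => cNeg η • omegaBar ψ 0))) ∧
    (∀ v : WhittakerL ψ 0, v ≠ 0 →
      v ∈ Submodule.span ℂ
        (insert (omegaBar ψ 0) (Set.range fun η : OddPartition => cNeg η • omegaBar ψ 0)) →
      IsWhittakerVector ψ v) := by
  have hC : ψ ⟨Twisted.C 1, Twisted.C_mem_pos le_rfl⟩ ≠ 0 := by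
    simpa only [Twisted.C_of_odd odd_one] using hψ
  refine ⟨fun χ v hv => ?_, fun v hv h => isWhittakerVector_iff.mpr ⟨hv, cSpan_isPosEigenvector v h⟩⟩
  obtain ⟨hv0, hv⟩ := isWhittakerVector_iff.mp hv
  refine ⟨hv0, ?_⟩
  obtain ⟨r, hr, rfl⟩ := LevelZeroRep.exists_cAlgebra_eq isCyclic_omegaBar isPosEigenvector_omegaBar
    hC hv0 hv
  exact LevelZeroRep.cAlgebra_apply_mem isCyclic_omegaBar isPosEigenvector_omegaBar
    (S := cSpan ψ) (Submodule.subset_span (Or.inl rfl))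
    (fun i hi v hv => toU_C_smul_mem_cSpan hi v hv) hr
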